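/- **Setting.** Let $d\ge 1$ and let $\mathcal P=\{(p_z)_{z\in\mathbb Z^d}: p_z\ge 0,\ \sum_z p_z=1\}$. An environment is $\omega=(\omega_x)_{x\in\mathbb Z^d}\in\mathcal P^{\mathbb Z^d}$, where $\omega_x=(\omega_{x,z})_{z\in\mathbb Z^d}$, and $\pi_{x,y}(\omega)=\omega_{x,y-x}$. Let $\mathbb P$ be an i.i.d. product measure on $\mathcal P^{\mathbb Z^d}$ (with its product $\sigma$-field), with expectation $\mathbb E$. For fixed $\omega$, $P_0^\omega$ is the law of the Markov chain $(X_n)_{n\ge0}$ on $\mathbb Z^d$ with $X_0=0$ and transition probabilities $\pi_{x,y}(\omega)$. The averaged law of the walk is $P_0=\int P_0^\omega\,\mathbb P(d\omega)$, with expectation $E_0$. Fix $\hat u\in\mathbb Z^d$. Let $\tau_1$ be the first time $n\ge1$ such that $$\sup_{m<n}X_m\cdot\hat u< X_n\cdot\hat u=\inf_{m\ge n}X_m\cdot\hat u$$ ($\tau_1=\infty$ if there is no such $n$), and let $\beta=\inf\{n\ge0: X_n\cdot\hat u<X_0\cdot\hat u\}$ (with $\inf\emptyset=\infty$). **Assumptions.**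 * Transience: $P_0\{X_n\cdot\hat u\to\infty\}=1$. * Moments: $E_0(\tau_1^{p})<\infty$ for some $p>176d$. * Bounded steps: there is a constant $M\in(0,\infty)$ such that $\mathbb P\{\pi_{0,z}=0\}=1$ whenever $|z|>M$ (Euclidean norm). * Regularity: the set $\{z:\mathbb E\pi_{0,z}>0\}$ is not contained in $\mathbb R w$ for any $w\in\mathbb R^d$, and $\mathbb P\{\exists z\ne0:\ \pi_{0,0}+\pi_{0,z}=1\}<1$. Define $$v=\frac{E_0[X_{\tau_1}\mid\beta=\infty]}{E_0[\tau_1\mid\beta=\infty]},\qquad \mathfrak D=\frac{E_0\bigl[(X_{\tau_1}-\tau_1v)(X_{\tau_1}-\tau_1v)^t\mid\beta=\infty\bigr]}{E_0[\tau_1\mid\beta=\infty]}.$$ **Lemma.** For every $u\in\mathbb R^d$: $u^t\mathfrak D u=0$ if and only if $u$ is orthogonal to the linear span of $\{x-y:\ x,y\in\mathbb Z^d,\ \mathbb E[\pi_{0,x}]\,\mathbb E[\pi_{0,y}]>0\}$. -/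

import Mathlib

open MeasureTheory ProbabilityTheory Filter
open scoped ENNReal Matrix

namespace RWRE

/-- The sites of the `d`-dimensional integer lattice. -/
abbrev Site (d : ℕ) : Type := Fin d → ℤ

/-- A lattice point as a vector of Euclidean space. -/
noncomputable def toVec {d : ℕ} (x : Site d) : EuclideanSpace ℝ (Fin d) :=
  WithLp.toLp 2 (fun i => (x i : ℝ))

/-- The simplex of all probability vectors on the lattice (with the trace of the product
σ-field). -/
abbrev ProbVec (d : ℕ) : Type :=
  {p : Site d → ℝ // (∀ z, 0 ≤ p z) ∧ HasSum p 1}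

/-- Environments: a probability vector at each site; this type carries the product σ-field. -/
abbrev Env (d : ℕ) : Type := Site d → ProbVec d

/-- Infinite lattice paths `(x 0, x 1, x 2, …)`, with the product σ-field. -/
abbrev Path (d : ℕ) : Type := ℕ → Site d

/-- The transition probability `π_{x,y}(ω) = ω_{x,y-x}`. -/
def jumpProb {d : ℕ} (ω : Env d) (x y : Site d) : ℝ := (ω x).1 (y - x)

/-! ### The quenched walk -/

lemma measurable_jumpProb {d : ℕ} (x y : Site d) :
    Measurable fun ω : Env d => jumpProb ω x y :=
  (measurable_pi_apply (y - x)).comp (measurable_subtype_coe.comp (measurable_pi_apply x))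

lemma tsum_jumpProb {d : ℕ} (ω : Env d) (x : Site d) :
    ∑' y, ENNReal.ofReal (jumpProb ω x y) = 1 := by
  have h := (ω x).2.2
  have h2 : HasSum (fun y => jumpProb ω x y) 1 := by
    have := (Equiv.subRight x).hasSum_iff.mpr h
    simpa [Function.comp_def, jumpProb] using this
  have h3 := ENNReal.ofReal_tsum_of_nonneg (f := fun y => jumpProb ω x y)
    (fun y => (ω x).2.1 _) h2.summable
  rw [← h3, h2.tsum_eq]
  simp

/-- The one-step transition kernel in the environment `ω`: from `x` jump to `y` with
probability `π_{x,y}(ω)`. -/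
noncomputable def stepKernel {d : ℕ} (ω : Env d) : Kernel (Site d) (Site d) :=
  Kernel.ofFunOfCountable fun x =>
    Measure.sum fun y => ENNReal.ofReal (jumpProb ω x y) • Measure.dirac y

lemma stepKernel_singleton {d : ℕ} (ω : Env d) (x y : Site d) :
    stepKernel ω x {y} = ENNReal.ofReal (jumpProb ω x y) := by
  change (Measure.sum fun y => ENNReal.ofReal (jumpProb ω x y) • Measure.dirac y) {y} = _
  rw [Measure.sum_apply _ (measurableSet_singleton y), tsum_eq_single y]
  · simp
  · intro b hb
    simp [hb]

instance {d : ℕ} (ω : Env d) : IsMarkovKernel (stepKernel ω) := by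
  refine ⟨fun x => ⟨?_⟩⟩
  change (Measure.sum fun y => ENNReal.ofReal (jumpProb ω x y) • Measure.dirac y) Set.univ = 1
  rw [Measure.sum_apply _ MeasurableSet.univ]
  simpa using tsum_jumpProb ω x

/-- The transition out of the last position of a path up to time `n`. -/
noncomputable def histKernel {d : ℕ} (ω : Env d) (n : ℕ) :
    Kernel ((i : Finset.Iic n) → Site d) (Site d) :=
  (stepKernel ω).comap (fun h => h ⟨n, Finset.mem_Iic.2 le_rfl⟩) (measurable_pi_apply _)

instance {d : ℕ} (ω : Env d) (n : ℕ) : IsMarkovKernel (histKernel ω n) := by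
  unfold histKernel; infer_instance

/-- The quenched path measure `P_z^ω`: the law of the Markov chain with transition
probabilities `π_{x,y}(ω)` started at `z`. -/
noncomputable def quenched {d : ℕ} (z : Site d) (ω : Env d) : Measure (Path d) :=
  Kernel.traj (X := fun _ => Site d) (histKernel ω) 0 (fun _ => z)

instance {d : ℕ} (z : Site d) (ω : Env d) : IsProbabilityMeasure (quenched z ω) := by
  unfold quenched; infer_instance

/-- The paths that agree with `w` up to time `n`. -/
def cyl {d : ℕ} (n : ℕ) (w : Path d) : Set (Path d) := {x | ∀ i ≤ n, x i = w i}

lemma partialTraj_singleton {d : ℕ} (z : Site d) (ω : Env d) (n : ℕ) (w : Path d) :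
    Kernel.partialTraj (X := fun _ => Site d) (histKernel ω) 0 n (fun _ => z)
        {Preorder.frestrictLe n w} =
      (if w 0 = z then 1 else 0) *
        ∏ i ∈ Finset.range n, ENNReal.ofReal (jumpProb ω (w i) (w (i + 1))) := by
  induction n with
  | zero =>
    rw [Kernel.partialTraj_self, Kernel.id_apply, Measure.dirac_apply]
    by_cases h : w 0 = z
    · have : (fun _ => z) ∈ ({Preorder.frestrictLe 0 w} :
          Set ((i : Finset.Iic 0) → Site d)) := by
        rw [Set.mem_singleton_iff]
        funext i
        have hi : (i : ℕ) = 0 := Nat.le_zero.1 (Finset.mem_Iic.1 i.2)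
        simp [hi, h]
      simp [h, Set.indicator_of_mem this]
    · have : (fun _ => z) ∉ ({Preorder.frestrictLe 0 w} :
          Set ((i : Finset.Iic 0) → Site d)) := by
        rw [Set.mem_singleton_iff]
        intro hh
        exact h (congrFun hh ⟨0, Finset.mem_Iic.2 le_rfl⟩).symm
      simp [h, Set.indicator_of_notMem this]
  | succ n ih =>
    have key : ∀ y : (i : Finset.Iic n) → Site d,
        Kernel.partialTraj (X := fun _ => Site d) (histKernel ω) n (n + 1) y
          {Preorder.frestrictLe (n + 1) w} =
        Set.indicator {Preorder.frestrictLe n w}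
          (fun _ => ENNReal.ofReal (jumpProb ω (w n) (w (n + 1)))) y := by
      intro y
      have hpre : IicProdIoc (X := fun _ => Site d) n (n + 1) ⁻¹'
          {Preorder.frestrictLe (n + 1) w} =
          {Preorder.frestrictLe n w} ×ˢ
            ((MeasurableEquiv.piSingleton (X := fun _ => Site d) n).symm ⁻¹' {w (n + 1)}) := by
        ext ⟨f, g⟩
        simp only [Set.mem_preimage, Set.mem_singleton_iff, Set.mem_prod]
        constructor
        · intro h
          refine ⟨funext fun i => ?_, ?_⟩
          · have hi := Finset.mem_Iic.1 i.2
            have := congrFun h ⟨i, Finset.mem_Iic.2 (hi.trans n.le_succ)⟩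
            simpa [IicProdIoc, hi] using this
          · have := congrFun h ⟨n + 1, Finset.mem_Iic.2 le_rfl⟩
            have h3 : g ⟨n + 1, Finset.right_mem_Ioc.2 n.lt_succ_self⟩ = w (n + 1) := by
              simpa [IicProdIoc] using this
            exact h3
        · rintro ⟨h1, h2⟩
          funext ⟨i, hi⟩
          rcases Nat.lt_or_ge n i with hlt | hle
          · obtain rfl : i = n + 1 := le_antisymm (Finset.mem_Iic.1 hi) hlt
            have : g ⟨n + 1, Finset.right_mem_Ioc.2 n.lt_succ_self⟩ = w (n + 1) := h2
            simpa [IicProdIoc] using this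
          · have := congrFun h1 ⟨i, Finset.mem_Iic.2 hle⟩
            simpa [IicProdIoc, hle] using this
      have hstep : (histKernel ω n).map (MeasurableEquiv.piSingleton (X := fun _ => Site d) n) y
          ((MeasurableEquiv.piSingleton (X := fun _ => Site d) n).symm ⁻¹' {w (n + 1)}) =
          ENNReal.ofReal (jumpProb ω (y ⟨n, Finset.mem_Iic.2 le_rfl⟩) (w (n + 1))) := by
        rw [Kernel.map_apply' _ (MeasurableEquiv.measurable _) _
          ((MeasurableEquiv.measurable _) (measurableSet_singleton _)), ← Set.preimage_comp,
          MeasurableEquiv.symm_comp_self, Set.preimage_id, histKernel, Kernel.comap_apply,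
          stepKernel_singleton]
      rw [Kernel.partialTraj_succ_self, Kernel.map_apply' _ (by fun_prop) _
        (measurableSet_singleton _), hpre, Kernel.prod_apply, Measure.prod_prod,
        Kernel.id_apply, hstep, Measure.dirac_apply]
      by_cases hy : y = Preorder.frestrictLe n w
      · subst hy
        simp [Preorder.frestrictLe]
      · simp [Set.indicator_of_notMem, hy]
    rw [Kernel.partialTraj_succ_eq_comp (Nat.zero_le n),
      Kernel.comp_apply' _ _ _ (measurableSet_singleton _)]
    simp_rw [key]
    rw [lintegral_indicator (measurableSet_singleton _), setLIntegral_const, ih,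
      Finset.prod_range_succ]
    ring

/-- The finite-dimensional distributions of the quenched walk. -/
theorem quenched_cyl {d : ℕ} (z : Site d) (ω : Env d) (n : ℕ) (w : Path d) :
    quenched z ω (cyl n w) =
      (if w 0 = z then 1 else 0) *
        ∏ i ∈ Finset.range n, ENNReal.ofReal (jumpProb ω (w i) (w (i + 1))) := by
  rw [← partialTraj_singleton, ← Kernel.traj_map_frestrictLe_apply,
    Measure.map_apply (by fun_prop) (measurableSet_singleton _), quenched]
  congr 1
  ext x
  simp [cyl, funext_iff, Preorder.frestrictLe]

theorem measurable_quenched {d : ℕ} (z : Site d) : Measurable (quenched z : Env d → _) := by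
  classical
  let S : Set (Set (Path d)) := {s | s = ∅ ∨ ∃ n w, s = cyl n w}
  have hcyl : ∀ n (w : Path d), MeasurableSet (cyl n w) := by
    intro n w
    have : cyl n w = Preorder.frestrictLe (π := fun _ => Site d) n ⁻¹'
        {Preorder.frestrictLe n w} := by
      ext x
      simp [cyl, funext_iff, Preorder.frestrictLe]
    rw [this]
    exact (by fun_prop : Measurable (Preorder.frestrictLe (π := fun _ => Site d) n))
      (measurableSet_singleton _)
  have hgen : (inferInstance : MeasurableSpace (Path d)) = MeasurableSpace.generateFrom S := by
    apply le_antisymm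
    · refine iSup_le fun n => ?_
      rintro _ ⟨A, -, rfl⟩
      have : (fun x : Path d => x n) ⁻¹' A =
          ⋃ h : {h : (i : Finset.Iic n) → Site d // h ⟨n, Finset.mem_Iic.2 le_rfl⟩ ∈ A},
            cyl n (fun i => if hi : i ∈ Finset.Iic n then h.1 ⟨i, hi⟩ else 0) := by
        ext x
        simp only [Set.mem_preimage, Set.mem_iUnion, cyl, Set.mem_ofPred_eq]
        constructor
        · intro hx
          refine ⟨⟨Preorder.frestrictLe n x, hx⟩, fun i hi => ?_⟩
          simp [hi]
        · rintro ⟨h, hh⟩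
          have := hh n le_rfl
          simp only [Finset.mem_Iic, le_refl, dite_true] at this
          rw [this]
          exact h.2
      rw [this]
      exact MeasurableSet.iUnion fun h =>
        MeasurableSpace.measurableSet_generateFrom (Or.inr ⟨_, _, rfl⟩)
    · refine MeasurableSpace.generateFrom_le ?_
      rintro s (rfl | ⟨n, w, rfl⟩)
      · exact MeasurableSet.empty
      · exact hcyl n w
  have hpi : IsPiSystem S := by
    rintro s hs t ht ⟨x, hxs, hxt⟩
    rcases hs with rfl | ⟨n, w, rfl⟩
    · exact absurd hxs (Set.notMem_empty x)
    rcases ht with rfl | ⟨m, w', rfl⟩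
    · exact absurd hxt (Set.notMem_empty x)
    refine Or.inr ⟨max n m, x, ?_⟩
    ext y
    simp only [cyl, Set.mem_inter_iff, Set.mem_ofPred_eq] at hxs hxt ⊢
    constructor
    · rintro ⟨h1, h2⟩ i hi
      rcases le_max_iff.1 hi with h | h
      · rw [h1 i h, hxs i h]
      · rw [h2 i h, hxt i h]
    · intro h
      exact ⟨fun i hi => by rw [h i (le_max_of_le_left hi), hxs i hi],
        fun i hi => by rw [h i (le_max_of_le_right hi), hxt i hi]⟩
  refine Measurable.measure_of_isPiSystem_of_isProbabilityMeasure hgen hpi ?_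
  rintro s (rfl | ⟨n, w, rfl⟩)
  · simp
  · simp_rw [quenched_cyl]
    exact measurable_const.mul (Finset.measurable_prod _ fun i _ =>
      (measurable_jumpProb _ _).ennreal_ofReal)

/-- The quenched laws as a kernel from environments to paths. -/
noncomputable def quenchedKernel {d : ℕ} (z : Site d) : Kernel (Env d) (Path d) where
  toFun := quenched z
  measurable' := measurable_quenched z

instance {d : ℕ} (z : Site d) : IsMarkovKernel (quenchedKernel z) :=
  ⟨fun ω => inferInstanceAs (IsProbabilityMeasure (quenched z ω))⟩

/-! ### The averaged walk -/

/-- The i.i.d. product law on environments whose marginal at each site is `μ`. -/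
noncomputable def envLaw {d : ℕ} (μ : Measure (ProbVec d)) [IsProbabilityMeasure μ] :
    Measure (Env d) :=
  Measure.infinitePi fun _ => μ

instance {d : ℕ} (μ : Measure (ProbVec d)) [IsProbabilityMeasure μ] :
    IsProbabilityMeasure (envLaw μ) := by
  unfold envLaw; infer_instance

/-- The averaged law `P_z` of the walk: the marginal on paths of `P_z^ω(dx) ℙ(dω)`. -/
noncomputable def averaged {d : ℕ} (μ : Measure (ProbVec d)) [IsProbabilityMeasure μ]
    (z : Site d) : Measure (Path d) :=
  (envLaw μ ⊗ₘ quenchedKernel z).snd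

instance {d : ℕ} (μ : Measure (ProbVec d)) [IsProbabilityMeasure μ] (z : Site d) :
    IsProbabilityMeasure (averaged μ z) := by
  unfold averaged; infer_instance

/-- The averaged one-step probability `𝔼[π_{0,z}]`. -/
noncomputable def meanJump {d : ℕ} (μ : Measure (ProbVec d)) [IsProbabilityMeasure μ]
    (z : Site d) : ℝ :=
  ∫ ω, jumpProb ω 0 z ∂(envLaw μ)

/-! ### Regeneration -/

/-- `n ≥ 1` is a time with `sup_{m<n} x_m·û < x_n·û = inf_{m≥n} x_m·û`. -/
def IsRegen {d : ℕ} (uhat : Site d) (x : Path d) (n : ℕ) : Prop :=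
  1 ≤ n ∧ (∀ m < n, x m ⬝ᵥ uhat < x n ⬝ᵥ uhat) ∧ ∀ m ≥ n, x n ⬝ᵥ uhat ≤ x m ⬝ᵥ uhat

/-- The first regeneration time `τ₁` (`⊤` if there is none). -/
noncomputable def tau {d : ℕ} (uhat : Site d) (x : Path d) : ℕ∞ :=
  ⨅ (n : ℕ) (_ : IsRegen uhat x n), (n : ℕ∞)

/-- The first backtracking time `β` (`⊤` if there is none). -/
noncomputable def backtrack {d : ℕ} (uhat : Site d) (x : Path d) : ℕ∞ :=
  ⨅ (n : ℕ) (_ : x n ⬝ᵥ uhat < x 0 ⬝ᵥ uhat), (n : ℕ∞)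

/-- `τ₁` as a real number, where it is finite. -/
noncomputable def tauReal {d : ℕ} (uhat : Site d) (x : Path d) : ℝ :=
  ((tau uhat x).toNat : ℝ)

/-- The position `X_{τ₁}`, where `τ₁` is finite. -/
noncomputable def posTau {d : ℕ} (uhat : Site d) (x : Path d) : EuclideanSpace ℝ (Fin d) :=
  toVec (x (tau uhat x).toNat)

/-- The law `P_0(· | β = ∞)`. -/
noncomputable def regenLaw {d : ℕ} (μ : Measure (ProbVec d)) [IsProbabilityMeasure μ]
    (uhat : Site d) : Measure (Path d) :=
  ProbabilityTheory.cond (averaged μ 0) {x | backtrack uhat x = ⊤}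

/-- `E_0[τ₁ | β = ∞]`. -/
noncomputable def meanTau {d : ℕ} (μ : Measure (ProbVec d)) [IsProbabilityMeasure μ]
    (uhat : Site d) : ℝ :=
  ∫ x, tauReal uhat x ∂(regenLaw μ uhat)

/-- The velocity `v = E_0[X_{τ₁} | β = ∞] / E_0[τ₁ | β = ∞]`. -/
noncomputable def velocity {d : ℕ} (μ : Measure (ProbVec d)) [IsProbabilityMeasure μ]
    (uhat : Site d) : EuclideanSpace ℝ (Fin d) :=
  (meanTau μ uhat)⁻¹ • ∫ x, posTau uhat x ∂(regenLaw μ uhat)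

/-- The centered regeneration increment `X_{τ₁} - τ₁ v`. -/
noncomputable def centered {d : ℕ} (μ : Measure (ProbVec d)) [IsProbabilityMeasure μ]
    (uhat : Site d) (x : Path d) : EuclideanSpace ℝ (Fin d) :=
  posTau uhat x - tauReal uhat x • velocity μ uhat

/-- The matrix `𝔇 = E_0[(X_{τ₁} - τ₁ v)(X_{τ₁} - τ₁ v)ᵗ | β = ∞] / E_0[τ₁ | β = ∞]`. -/
noncomputable def diffusion {d : ℕ} (μ : Measure (ProbVec d)) [IsProbabilityMeasure μ]
    (uhat : Site d) : Matrix (Fin d) (Fin d) ℝ :=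
  Matrix.of fun i j =>
    (∫ x, centered μ uhat x i * centered μ uhat x j ∂(regenLaw μ uhat)) / meanTau μ uhat

/-! ### Standing assumptions -/

/-- Transience in the direction `û`: `P_0{X_n·û → ∞} = 1`. -/
def Transient {d : ℕ} (μ : Measure (ProbVec d)) [IsProbabilityMeasure μ]
    (uhat : Site d) : Prop :=
  ∀ᵐ x ∂(averaged μ 0), Tendsto (fun n => x n ⬝ᵥ uhat) atTop atTop

/-- `E_0[τ₁^p] < ∞` for some `p > 176 d`. -/
def MomentHyp {d : ℕ} (μ : Measure (ProbVec d)) [IsProbabilityMeasure μ]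
    (uhat : Site d) : Prop :=
  ∃ p : ℝ, 176 * (d : ℝ) < p ∧
    ∫⁻ x, ((tau uhat x : ℕ∞) : ℝ≥0∞) ^ p ∂(averaged μ 0) < ∞

/-- Bounded steps. -/
def BoundedSteps {d : ℕ} (μ : Measure (ProbVec d)) [IsProbabilityMeasure μ] : Prop :=
  ∃ M : ℝ, 0 < M ∧ ∀ z : Site d, M < ‖toVec z‖ → ∀ᵐ ω ∂(envLaw μ), jumpProb ω 0 z = 0

/-- Regularity: the admissible steps do not lie on a line through the origin, and with
positive probability the jumps out of the origin charge at least two nonzero steps. -/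
def Regular {d : ℕ} (μ : Measure (ProbVec d)) [IsProbabilityMeasure μ] : Prop :=
  (∀ w : EuclideanSpace ℝ (Fin d),
    ¬ (toVec '' {z : Site d | 0 < meanJump μ z} ⊆ {y | ∃ c : ℝ, y = c • w})) ∧
  envLaw μ {ω | ∃ z : Site d, z ≠ 0 ∧ jumpProb ω 0 0 + jumpProb ω 0 z = 1} < 1

end RWRE

namespace RWRE

/-! ### Cylinder sets -/

/-! The form `uᵗ𝔇u` is a positive multiple of the conditional second moment of `u·(X_τ - τ v)`, so
it vanishes exactly when `u·X_τ = τ (u·v)` almost surely given no backtracking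
(`quadForm_eq_zero_iff`). If all admissible steps have the same component `c` along `u`, then `u·X_n
= n c` for all `n`, and the identity follows.

For the converse put `c = u·v`. A possible finite path that stays above its start and strictly below
its endpoint can, with positive probability, be continued without going below the endpoint: the two
events read disjoint sets of sites. Its endpoint is then a regeneration, and cutting at the first
regeneration shows by induction that its displacement along `u` is `c` times its length
(`inner_displacement_of_posPath`).

This relation is tested on explicit paths: a long run of an upward step `z₀`, the step under study,
and another run of `z₀` (`CycleRelation.jump_transverse`). Distinct steps from one site need not be
jointly possible, so the path must not reuse a site with a different step. When the step `s` could
be undone by repeating `z₀`, a step `y` off the line of `z₀`, supplied by regularity, is inserted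
before and after `s` (`CycleRelation.jump_parallel`). For the zero step, idling once before a jump
lengthens the path without moving it, which forces `c = 0`. -/

lemma cyl_eq_preimage {d : ℕ} (n : ℕ) (w : Path d) :
    cyl n w = Preorder.frestrictLe (π := fun _ => Site d) n ⁻¹' {Preorder.frestrictLe n w} := by
  ext x
  simp [cyl, funext_iff, Preorder.frestrictLe]

lemma measurableSet_cyl {d : ℕ} (n : ℕ) (w : Path d) : MeasurableSet (cyl n w) := by
  rw [cyl_eq_preimage]
  exact (by fun_prop : Measurable (Preorder.frestrictLe (π := fun _ => Site d) n))
    (measurableSet_singleton _)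

/-- The cylinder sets, with the empty set adjoined. -/
def cylinders (d : ℕ) : Set (Set (Path d)) := {s | s = ∅ ∨ ∃ n w, s = cyl n w}

lemma generateFrom_cylinders (d : ℕ) :
    (inferInstance : MeasurableSpace (Path d)) = MeasurableSpace.generateFrom (cylinders d) := by
  classical
  apply le_antisymm
  · refine iSup_le fun n => ?_
    rintro _ ⟨A, -, rfl⟩
    have : (fun x : Path d => x n) ⁻¹' A =
        ⋃ h : {h : (i : Finset.Iic n) → Site d // h ⟨n, Finset.mem_Iic.2 le_rfl⟩ ∈ A},
          cyl n (fun i => if hi : i ∈ Finset.Iic n then h.1 ⟨i, hi⟩ else 0) := by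
      ext x
      simp only [Set.mem_preimage, Set.mem_iUnion, cyl, Set.mem_ofPred_eq]
      constructor
      · intro hx
        refine ⟨⟨Preorder.frestrictLe n x, hx⟩, fun i hi => ?_⟩
        simp [hi]
      · rintro ⟨h, hh⟩
        have := hh n le_rfl
        simp only [Finset.mem_Iic, le_refl, dite_true] at this
        rw [this]
        exact h.2
    rw [this]
    exact MeasurableSet.iUnion fun h =>
      MeasurableSpace.measurableSet_generateFrom (Or.inr ⟨_, _, rfl⟩)
  · refine MeasurableSpace.generateFrom_le ?_
    rintro s (rfl | ⟨n, w, rfl⟩)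
    · exact MeasurableSet.empty
    · exact measurableSet_cyl n w

lemma isPiSystem_cylinders (d : ℕ) : IsPiSystem (cylinders d) := by
  rintro s hs t ht ⟨x, hxs, hxt⟩
  rcases hs with rfl | ⟨n, w, rfl⟩
  · exact absurd hxs (Set.notMem_empty x)
  rcases ht with rfl | ⟨m, w', rfl⟩
  · exact absurd hxt (Set.notMem_empty x)
  refine Or.inr ⟨max n m, x, ?_⟩
  ext y
  simp only [cyl, Set.mem_inter_iff, Set.mem_ofPred_eq] at hxs hxt ⊢
  constructor
  · rintro ⟨h1, h2⟩ i hi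
    rcases le_max_iff.1 hi with h | h
    · rw [h1 i h, hxs i h]
    · rw [h2 i h, hxt i h]
  · intro h
    exact ⟨fun i hi => by rw [h i (le_max_of_le_left hi), hxs i hi],
      fun i hi => by rw [h i (le_max_of_le_right hi), hxt i hi]⟩

/-- The cylinders form a π-system generating the product σ-field. Identities between path laws
thereby reduce to the product formula `quenched_cyl`. -/
lemma measure_ext_of_cyl {d : ℕ} {P Q : Measure (Path d)} [IsFiniteMeasure P]
    (huniv : P Set.univ = Q Set.univ) (h : ∀ n w, P (cyl n w) = Q (cyl n w)) : P = Q := by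
  refine ext_of_generate_finite (cylinders d) (generateFrom_cylinders d)
    (isPiSystem_cylinders d) ?_ huniv
  rintro s (rfl | ⟨n, w, rfl⟩)
  · simp
  · exact h n w

/-- A set that is null on each cylinder of length `n` is null. -/
lemma measure_eq_zero_of_forall_cyl {d : ℕ} (P : Measure (Path d)) (n : ℕ) (D : Set (Path d))
    (h : ∀ w, P (cyl n w ∩ D) = 0) : P D = 0 := by
  classical
  -- There are countably many initial segments of length `n`; the value `0` after time `n` is a
  -- filler that the cylinder ignores.
  have hD : D ⊆ ⋃ g : (i : Finset.Iic n) → Site d,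
      cyl n (fun i => if hi : i ∈ Finset.Iic n then g ⟨i, hi⟩ else 0) ∩ D := by
    intro x hx
    refine Set.mem_iUnion.2 ⟨Preorder.frestrictLe n x, fun i hi => ?_, hx⟩
    simp [hi]
  exact measure_mono_null hD (measure_iUnion_null fun g => h _)

/-- Almost every path has only cylinders of positive measure. -/
lemma ae_cyl_ne_zero {d : ℕ} (P : Measure (Path d)) : ∀ᵐ x ∂P, ∀ n, P (cyl n x) ≠ 0 := by
  rw [ae_all_iff]
  intro n
  rw [ae_iff]
  refine measure_eq_zero_of_forall_cyl P n _ fun w => ?_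
  by_cases hw : P (cyl n w) = 0
  · exact measure_mono_null Set.inter_subset_left hw
  · have : cyl n w ∩ {x | ¬ P (cyl n x) ≠ 0} = ∅ := by
      ext x
      simp only [Set.mem_inter_iff, Set.mem_ofPred_eq, Set.mem_empty_iff_false, iff_false, not_and,
        not_not]
      intro hx
      have : cyl n x = cyl n w := by
        ext y
        exact ⟨fun hy i hi => (hy i hi).trans (hx i hi),
          fun hy i hi => (hy i hi).trans (hx i hi).symm⟩
      rwa [this]
    rw [this]; simp

/-! ### The Markov property and translations -/

/-- The path after time `n`. -/
def shiftPath {d : ℕ} (n : ℕ) (x : Path d) : Path d := fun i => x (n + i)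

lemma measurable_shiftPath {d : ℕ} (n : ℕ) : Measurable (shiftPath n : Path d → Path d) :=
  measurable_pi_lambda _ fun i => measurable_pi_apply (n + i)

/-- Concatenation of two paths at time `n`. -/
def concatPath {d : ℕ} (n : ℕ) (w w' : Path d) : Path d :=
  fun i => if i ≤ n then w i else w' (i - n)

/-- Time `n` is read by both cylinders, as the end of `w` and as the start of `w'`, hence the
matching condition. -/
lemma cyl_inter_shiftPath {d : ℕ} (n m : ℕ) (w w' : Path d) (h : w' 0 = w n) :
    cyl n w ∩ shiftPath n ⁻¹' cyl m w' = cyl (n + m) (concatPath n w w') := by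
  ext x
  simp only [cyl, Set.mem_inter_iff, Set.mem_ofPred_eq, Set.mem_preimage, shiftPath, concatPath]
  constructor
  · rintro ⟨h1, h2⟩ i hi
    split_ifs with hin
    · exact h1 i hin
    · have := h2 (i - n) (by omega)
      rwa [show n + (i - n) = i by omega] at this
  · intro hx
    refine ⟨fun i hi => ?_, fun i hi => ?_⟩
    · have := hx i (by omega)
      rwa [if_pos hi] at this
    · have := hx (n + i) (by omega)
      split_ifs at this with hin
      · obtain rfl : i = 0 := by omega
        rw [h]; exact this
      · simpa using this

/-- Both sides are finite measures in `D`; on cylinders the identity is the splitting of a product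
of jump probabilities at time `n`. -/
theorem quenched_markov {d : ℕ} (z : Site d) (ω : Env d) (n : ℕ) (w : Path d)
    {D : Set (Path d)} (hD : MeasurableSet D) :
    quenched z ω (cyl n w ∩ shiftPath n ⁻¹' D) =
      quenched z ω (cyl n w) * quenched (w n) ω D := by
  have key : ((quenched z ω).restrict (cyl n w)).map (shiftPath n) =
      quenched z ω (cyl n w) • quenched (w n) ω := by
    have hval : ∀ E, MeasurableSet E → ((quenched z ω).restrict (cyl n w)).map (shiftPath n) E =
        quenched z ω (cyl n w ∩ shiftPath n ⁻¹' E) := fun E hE => by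
      rw [Measure.map_apply (measurable_shiftPath n) hE,
        Measure.restrict_apply (measurable_shiftPath n hE), Set.inter_comm]
    refine measure_ext_of_cyl ?_ fun m w' => ?_
    · rw [hval _ MeasurableSet.univ]; simp
    · rw [hval _ (measurableSet_cyl m w'), Measure.smul_apply, smul_eq_mul]
      by_cases h : w' 0 = w n
      · rw [cyl_inter_shiftPath n m w w' h, quenched_cyl, quenched_cyl, quenched_cyl,
          Finset.prod_range_add, if_pos h, one_mul, mul_assoc]
        have e0 : concatPath n w w' 0 = w 0 := by simp [concatPath]
        rw [e0]
        congr 1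
        · congr 1
          · refine Finset.prod_congr rfl fun i hi => ?_
            have := Finset.mem_range.1 hi
            simp [concatPath, this.le, Nat.succ_le_of_lt this]
          · refine Finset.prod_congr rfl fun i hi => ?_
            have e1 : concatPath n w w' (n + i) = w' i := by
              rcases Nat.eq_zero_or_pos i with rfl | hi'
              · simp [concatPath, h]
              · simp [concatPath, hi'.ne']
            have e2 : concatPath n w w' (n + i + 1) = w' (i + 1) := by
              rw [concatPath, if_neg (by omega)]; congr 1; omega
            rw [e1, e2]
      -- If `w'` does not start where `w` ends, both sides vanish.
      · have : cyl n w ∩ shiftPath n ⁻¹' cyl m w' = ∅ := by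
          ext x
          simp only [cyl, Set.mem_inter_iff, Set.mem_ofPred_eq, Set.mem_preimage, shiftPath,
            Set.mem_empty_iff_false, iff_false, not_and]
          intro h1 h2
          exact h ((h2 0 (Nat.zero_le _)).symm.trans (h1 n le_rfl))
        rw [this, quenched_cyl (w n), if_neg h]; simp
  have := congrArg (fun P => P D) key
  rw [Measure.map_apply (measurable_shiftPath n) hD,
    Measure.restrict_apply (measurable_shiftPath n hD), Measure.smul_apply, smul_eq_mul,
    Set.inter_comm] at this
  exact this

/-- The translate of a path. -/
def translatePath {d : ℕ} (a : Site d) (x : Path d) : Path d := fun i => x i + a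

lemma measurable_translatePath {d : ℕ} (a : Site d) :
    Measurable (translatePath a : Path d → Path d) :=
  measurable_pi_lambda _ fun i =>
    (measurable_of_countable fun y : Site d => y + a).comp (measurable_pi_apply i)

/-- The environment seen from the site `a`. -/
def translateEnv {d : ℕ} (a : Site d) (ω : Env d) : Env d := fun x => ω (x + a)

lemma measurable_translateEnv {d : ℕ} (a : Site d) :
    Measurable (translateEnv a : Env d → Env d) :=
  measurable_pi_lambda _ fun x => measurable_pi_apply (x + a)

lemma map_translateEnv {d : ℕ} (μ : Measure (ProbVec d)) [IsProbabilityMeasure μ] (a : Site d) :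
    (envLaw μ).map (translateEnv a) = envLaw μ :=
  Measure.map_infinitePi_infinitePi_of_inj (P := fun _ : Site d => μ)
    (f := fun x : Site d => x + a) (add_left_injective a)

lemma map_translatePath_quenched {d : ℕ} (a : Site d) (ω : Env d) :
    (quenched 0 (translateEnv a ω)).map (translatePath a) = quenched a ω := by
  have := Measure.isProbabilityMeasure_map (μ := quenched 0 (translateEnv a ω))
    (measurable_translatePath a).aemeasurable
  refine measure_ext_of_cyl (by simp) fun n w => ?_
  rw [Measure.map_apply (measurable_translatePath a) (measurableSet_cyl n w)]
  have : translatePath a ⁻¹' cyl n w = cyl n (translatePath (-a) w) := by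
    ext x
    simp only [cyl, Set.mem_preimage, Set.mem_ofPred_eq, translatePath]
    refine forall₂_congr fun i _ => ?_
    rw [← sub_eq_add_neg, eq_sub_iff_add_eq]
  rw [this, quenched_cyl, quenched_cyl]
  simp [translatePath, jumpProb, translateEnv, ← sub_eq_add_neg, sub_eq_zero]

lemma averaged_apply {d : ℕ} (μ : Measure (ProbVec d)) [IsProbabilityMeasure μ] (z : Site d)
    {D : Set (Path d)} (hD : MeasurableSet D) :
    averaged μ z D = ∫⁻ ω, quenched z ω D ∂(envLaw μ) := by
  rw [averaged, Measure.snd_compProd, Measure.bind_apply hD (Kernel.aemeasurable _)]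
  rfl

lemma measurable_quenched_apply {d : ℕ} (z : Site d) {D : Set (Path d)} (hD : MeasurableSet D) :
    Measurable fun ω => quenched z ω D :=
  (Measure.measurable_coe hD).comp (measurable_quenched z)

/-- Translating the path amounts to translating the environment, whose i.i.d. law is invariant. -/
lemma map_translatePath_averaged {d : ℕ} (μ : Measure (ProbVec d)) [IsProbabilityMeasure μ]
    (a : Site d) : (averaged μ 0).map (translatePath a) = averaged μ a := by
  ext D hD
  rw [Measure.map_apply (measurable_translatePath a) hD,
    averaged_apply μ 0 (measurable_translatePath a hD), averaged_apply μ a hD]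
  conv_lhs => rw [← map_translateEnv μ a]
  rw [lintegral_map (measurable_quenched_apply 0 (measurable_translatePath a hD))
    (measurable_translateEnv a)]
  refine lintegral_congr fun ω => ?_
  rw [← map_translatePath_quenched a, Measure.map_apply (measurable_translatePath a) hD]

lemma averaged_eq_zero_iff {d : ℕ} (μ : Measure (ProbVec d)) [IsProbabilityMeasure μ] (z : Site d)
    {D : Set (Path d)} (hD : MeasurableSet D) :
    averaged μ z D = 0 ↔ ∀ᵐ ω ∂(envLaw μ), quenched z ω D = 0 := by
  rw [averaged_apply μ z hD, lintegral_eq_zero_iff (measurable_quenched_apply z hD)]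
  rfl

/-! ### Independence of the past and the future of a path -/

/-- With positive probability the environment allows the first `n` steps of `w`. -/
def PosPath {d : ℕ} (μ : Measure (ProbVec d)) [IsProbabilityMeasure μ] (n : ℕ)
    (w : Path d) : Prop :=
  envLaw μ {ω | ∀ i < n, 0 < jumpProb ω (w i) (w (i + 1))} ≠ 0

lemma PosPath.shift {d : ℕ} {μ : Measure (ProbVec d)} [IsProbabilityMeasure μ] {n : ℕ}
    {w : Path d} (h : PosPath μ n w) (k : ℕ) : PosPath μ (n - k) (shiftPath k w) := by
  refine fun h0 => h (measure_mono_null ?_ h0)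
  intro ω hω i hi
  exact hω (k + i) (by omega)

lemma quenched_cyl_ne_zero_iff {d : ℕ} (z : Site d) (ω : Env d) (n : ℕ) (w : Path d) :
    quenched z ω (cyl n w) ≠ 0 ↔ w 0 = z ∧ ∀ i < n, 0 < jumpProb ω (w i) (w (i + 1)) := by
  rw [quenched_cyl]
  simp [Finset.prod_eq_zero_iff]

lemma averaged_cyl_ne_zero_iff {d : ℕ} (μ : Measure (ProbVec d)) [IsProbabilityMeasure μ]
    (z : Site d) (n : ℕ) (w : Path d) :
    averaged μ z (cyl n w) ≠ 0 ↔ w 0 = z ∧ PosPath μ n w := by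
  rw [Ne, averaged_eq_zero_iff μ z (measurableSet_cyl n w), PosPath, ae_iff]
  simp_rw [← Ne.eq_def, quenched_cyl_ne_zero_iff]
  by_cases h : w 0 = z <;> simp [h]

/-- A nonnegative integrable function has positive integral exactly when its support is not null,
and the support here depends only on the marginal at the origin. -/
lemma meanJump_pos_iff {d : ℕ} (μ : Measure (ProbVec d)) [IsProbabilityMeasure μ] (z : Site d) :
    0 < meanJump μ z ↔ μ {p | 0 < p.1 z} ≠ 0 := by
  have hle : ∀ ω : Env d, jumpProb ω 0 z ≤ 1 := fun ω =>
    le_hasSum (ω 0).2.2 _ (fun j _ => (ω 0).2.1 j)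
  have hint : Integrable (fun ω : Env d => jumpProb ω 0 z) (envLaw μ) :=
    Integrable.of_bound (measurable_jumpProb 0 z).aestronglyMeasurable 1
      (ae_of_all _ fun ω => by
        rw [Real.norm_of_nonneg (show 0 ≤ jumpProb ω 0 z from (ω 0).2.1 _)]; exact hle ω)
  rw [meanJump, integral_pos_iff_support_of_nonneg (fun ω => (ω 0).2.1 _) hint, pos_iff_ne_zero]
  have hm : MeasurableSet {p : ProbVec d | 0 < p.1 z} :=
    measurableSet_lt measurable_const ((measurable_pi_apply z).comp measurable_subtype_coe)
  have : Function.support (fun ω : Env d => jumpProb ω 0 z) =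
      (fun ω => ω 0) ⁻¹' {p : ProbVec d | 0 < p.1 z} := by
    ext ω
    simp only [Function.mem_support, jumpProb, sub_zero, Set.mem_preimage, Set.mem_ofPred_eq]
    exact ⟨fun h => lt_of_le_of_ne ((ω 0).2.1 z) h.symm, fun h => h.ne'⟩
  rw [this, ← Measure.map_apply (measurable_pi_apply 0) hm, envLaw, Measure.infinitePi_map_eval]

/-- A path is possible if at each site the steps that it takes there are jointly possible. -/
lemma posPath_of_forall_site {d : ℕ} {μ : Measure (ProbVec d)} [IsProbabilityMeasure μ] {n : ℕ}
    {w : Path d}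
    (h : ∀ x, μ {p | ∀ i < n, w i = x → 0 < p.1 (w (i + 1) - x)} ≠ 0) : PosPath μ n w := by
  classical
  -- Only the finitely many sites visited before time `n` are constrained, so the event is a finite
  -- box and its probability factorises.
  have heq : {ω : Env d | ∀ i < n, 0 < jumpProb ω (w i) (w (i + 1))} =
      Set.pi ((Finset.range n).image w : Finset (Site d))
        (fun x => {p : ProbVec d | ∀ i < n, w i = x → 0 < p.1 (w (i + 1) - x)}) := by
    ext ω
    simp only [Set.mem_ofPred_eq, Set.mem_pi, Finset.coe_image, Finset.coe_range, Set.mem_image,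
      Set.mem_Iio, jumpProb]
    constructor
    · rintro hω x - i hi rfl
      exact hω i hi
    · intro hω i hi
      exact hω (w i) ⟨i, hi, rfl⟩ i hi rfl
  rw [PosPath, heq, envLaw, Measure.infinitePi_pi]
  · exact Finset.prod_ne_zero_iff.2 fun x _ => h x
  · intro x _
    simp only [Set.ofPred_forall]
    refine MeasurableSet.iInter fun i => MeasurableSet.iInter fun _ => MeasurableSet.iInter
      fun _ => ?_
    exact measurableSet_lt measurable_const ((measurable_pi_apply _).comp measurable_subtype_coe)

/-- The paths that never go below their initial level. -/
def stay {d : ℕ} (uhat : Site d) : Set (Path d) := {x | ∀ m, x 0 ⬝ᵥ uhat ≤ x m ⬝ᵥ uhat}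

lemma measurable_level {d : ℕ} (uhat : Site d) (n : ℕ) :
    Measurable fun x : Path d => x n ⬝ᵥ uhat :=
  (measurable_of_countable fun y : Site d => y ⬝ᵥ uhat).comp (measurable_pi_apply n)

lemma measurableSet_stay {d : ℕ} (uhat : Site d) : MeasurableSet (stay uhat) := by
  simp only [stay, Set.ofPred_forall]
  exact MeasurableSet.iInter fun m => measurableSet_le (measurable_level _ _) (measurable_level _ _)

lemma averaged_stay {d : ℕ} (μ : Measure (ProbVec d)) [IsProbabilityMeasure μ] (uhat a : Site d) :
    averaged μ a (stay uhat) = averaged μ 0 (stay uhat) := by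
  rw [← map_translatePath_averaged, Measure.map_apply (measurable_translatePath a)
    (measurableSet_stay uhat)]
  congr 1
  ext x
  simp [stay, translatePath]

/-- The probability of staying above the initial level depends only on the environment there. -/
lemma quenched_stay_congr {d : ℕ} (uhat a : Site d) {ω ω' : Env d}
    (h : ∀ x, a ⬝ᵥ uhat ≤ x ⬝ᵥ uhat → ω x = ω' x) :
    quenched a ω (stay uhat) = quenched a ω' (stay uhat) := by
  classical
  -- Staying above is the decreasing limit of these finite-horizon events. Each is a countable
  -- disjoint union of cylinders whose jumps all leave sites at or above the level of `a`.
  let C : ℕ → Set (Path d) := fun n => {x | ∀ m ≤ n, a ⬝ᵥ uhat ≤ x m ⬝ᵥ uhat}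
  have hC : ∀ n, MeasurableSet (C n) := fun n => by
    simp only [C, Set.ofPred_forall]
    exact MeasurableSet.iInter fun m => MeasurableSet.iInter fun _ =>
      measurableSet_le measurable_const (measurable_level _ _)
  have hanti : Antitone C := fun n m hnm x hx i hi => hx i (hi.trans hnm)
  have h0 : ∀ ω : Env d, ∀ᵐ x ∂(quenched a ω), x 0 = a := fun ω => by
    filter_upwards [ae_cyl_ne_zero (quenched a ω)] with x hx
    exact ((quenched_cyl_ne_zero_iff a ω 0 x).1 (hx 0)).1
  have hstay : ∀ ω : Env d, quenched a ω (stay uhat) = quenched a ω (⋂ n, C n) := fun ω => by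
    refine measure_congr ?_
    filter_upwards [h0 ω] with x hx
    refine propext ?_
    change x ∈ stay uhat ↔ x ∈ ⋂ n, C n
    simp only [stay, C, Set.mem_ofPred_eq, Set.mem_iInter, hx]
    exact ⟨fun h n m _ => h m, fun h m => h m m le_rfl⟩
  have hlim : ∀ ω : Env d, quenched a ω (stay uhat) = ⨅ n, quenched a ω (C n) := fun ω => by
    rw [hstay, Antitone.measure_iInter hanti (fun n => (hC n).nullMeasurableSet)
      ⟨0, measure_ne_top _ _⟩]
  have hCn : ∀ n, quenched a ω (C n) = quenched a ω' (C n) := fun n => by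
    let W : ((i : Finset.Iic n) → Site d) → Path d :=
      fun g i => if hi : i ∈ Finset.Iic n then g ⟨i, hi⟩ else 0
    have hW : C n = ⋃ g : {g : (i : Finset.Iic n) → Site d // W g ∈ C n}, cyl n (W g) := by
      ext x
      simp only [Set.mem_iUnion]
      constructor
      · intro hx
        have hWx : ∀ i ≤ n, x i = W (Preorder.frestrictLe n x) i := fun i hi => by
          simp [W, hi]
        exact ⟨⟨Preorder.frestrictLe n x, fun m hm => (hWx m hm) ▸ hx m hm⟩, hWx⟩
      · rintro ⟨g, hg⟩ m hm
        rw [hg m hm]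
        exact g.2 m hm
    have hdisj : Pairwise (Function.onFun Disjoint
        fun g : {g : (i : Finset.Iic n) → Site d // W g ∈ C n} => cyl n (W g)) := by
      intro g g' hgg
      refine Set.disjoint_left.2 fun x hx hx' => hgg (Subtype.ext (funext fun i => ?_))
      have := (hx i (Finset.mem_Iic.1 i.2)).symm.trans (hx' i (Finset.mem_Iic.1 i.2))
      simpa [W, Finset.mem_Iic.1 i.2] using this
    rw [hW, measure_iUnion hdisj fun g => measurableSet_cyl _ _,
      measure_iUnion hdisj fun g => measurableSet_cyl _ _]
    refine tsum_congr fun g => ?_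
    rw [quenched_cyl, quenched_cyl]
    congr 1
    refine Finset.prod_congr rfl fun i hi => ?_
    rw [jumpProb, jumpProb, h _ (g.2 i (Finset.mem_range.1 hi).le)]
  rw [hlim, hlim]
  exact iInf_congr hCn

/-- Events that depend on the environment in disjoint sets of sites are independent. -/
lemma envLaw_inter {d : ℕ} (μ : Measure (ProbVec d)) [IsProbabilityMeasure μ] (F : Set (Site d))
    {A B : Set (Env d)} (hA : MeasurableSet A) (hB : MeasurableSet B)
    (hAF : ∀ ω ω' : Env d, (∀ x ∈ F, ω x = ω' x) → (ω ∈ A → ω' ∈ A))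
    (hBF : ∀ ω ω' : Env d, (∀ x ∉ F, ω x = ω' x) → (ω ∈ B → ω' ∈ B)) :
    envLaw μ (A ∩ B) = envLaw μ A * envLaw μ B := by
  classical
  let m : Site d → MeasurableSpace (Env d) := fun x =>
    MeasurableSpace.comap (fun ω : Env d => ω x) inferInstance
  have hind : iIndep m (envLaw μ) :=
    iIndepFun_infinitePi (P := fun _ : Site d => μ) (X := fun _ p => p) (fun _ => measurable_id)
  have hI := indep_iSup_of_disjoint (fun x => (measurable_pi_apply x).comap_le) hind
    (disjoint_compl_right (a := F))
  obtain ⟨p0⟩ : Nonempty (ProbVec d) := by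
    by_contra hne
    rw [not_nonempty_iff] at hne
    have := measure_univ (μ := μ)
    rw [Set.eq_empty_of_isEmpty Set.univ] at this
    simp at this
  have hmeas : ∀ (G : Set (Site d)) (C : Set (Env d)), MeasurableSet C →
      (∀ ω ω' : Env d, (∀ x ∈ G, ω x = ω' x) → (ω ∈ C → ω' ∈ C)) →
      MeasurableSet[⨆ x ∈ G, m x] C := by
    intro G C hC hCG
    -- Freezing the environment off `G` is measurable for the coordinates in `G`, and an event that
    -- depends only on `G` is its own preimage under this map.
    let φ : Env d → Env d := fun ω x => if x ∈ G then ω x else p0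
    have hφ : Measurable[⨆ x ∈ G, m x] φ := by
      refine @measurable_pi_lambda _ _ _ (_) _ _ fun x => ?_
      by_cases hx : x ∈ G
      · simp only [φ, hx, if_true]
        refine Measurable.mono (comap_measurable (fun ω : Env d => ω x)) ?_ le_rfl
        exact le_iSup₂ (f := fun x (_ : x ∈ G) => m x) x hx
      · simp only [φ, hx, if_false]
        exact measurable_const
    have : C = φ ⁻¹' C := by
      ext ω
      refine ⟨hCG _ _ fun x hx => ?_, hCG _ _ fun x hx => ?_⟩ <;> simp [φ, hx]
    rw [this]
    exact hφ hC
  exact (Indep_iff _ _ _).1 hI A B (hmeas F A hA hAF) (hmeas Fᶜ B hB hBF)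

/-- A possible path that ends strictly above its past can be followed by a stay above its
endpoint. -/
theorem averaged_cyl_inter_stay_ne_zero {d : ℕ} {μ : Measure (ProbVec d)}
    [IsProbabilityMeasure μ] {uhat : Site d} (hstay : averaged μ 0 (stay uhat) ≠ 0) {n : ℕ}
    {w : Path d} (hw : PosPath μ n w) (hlt : ∀ i < n, w i ⬝ᵥ uhat < w n ⬝ᵥ uhat) :
    averaged μ (w 0) (cyl n w ∩ shiftPath n ⁻¹' stay uhat) ≠ 0 := by
  rw [Ne, averaged_eq_zero_iff μ _ ((measurableSet_cyl n w).inter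
    (measurable_shiftPath n (measurableSet_stay uhat)))]
  simp_rw [quenched_markov _ _ n w (measurableSet_stay uhat)]
  rw [ae_iff]
  have hset : {ω : Env d | ¬ quenched (w 0) ω (cyl n w) * quenched (w n) ω (stay uhat) = 0} =
      {ω | ∀ i < n, 0 < jumpProb ω (w i) (w (i + 1))} ∩
        {ω | quenched (w n) ω (stay uhat) ≠ 0} := by
    ext ω
    simp only [Set.mem_ofPred_eq, Set.mem_inter_iff, mul_eq_zero, not_or, ← Ne.eq_def,
      quenched_cyl_ne_zero_iff, true_and]
  -- The steps of `w` leave sites strictly below the level of `w n`, while the stay reads only sites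
  -- at or above it.
  rw [hset, envLaw_inter μ {x | x ⬝ᵥ uhat < w n ⬝ᵥ uhat}]
  · refine mul_ne_zero hw fun h0 => hstay ?_
    rw [← averaged_stay μ uhat (w n), averaged_eq_zero_iff μ _ (measurableSet_stay uhat), ae_iff]
    exact h0
  · simp only [Set.ofPred_forall]
    exact MeasurableSet.iInter fun i => MeasurableSet.iInter fun _ =>
      measurableSet_lt measurable_const (measurable_jumpProb _ _)
  · exact (measurable_quenched_apply _ (measurableSet_stay uhat))
      (measurableSet_singleton 0).compl
  · intro ω ω' h hω i hi
    rw [jumpProb, ← h (w i) (hlt i hi)]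
    exact hω i hi
  · intro ω ω' h hω
    change quenched (w n) ω' (stay uhat) ≠ 0
    rwa [← quenched_stay_congr uhat (w n) fun x hx => h x (not_lt.2 hx)]

/-! ### Regeneration times -/

lemma backtrack_eq_top_iff {d : ℕ} (uhat : Site d) (x : Path d) :
    backtrack uhat x = ⊤ ↔ x ∈ stay uhat := by
  simp [backtrack, stay, iInf_eq_top]

lemma tau_eq_top_iff {d : ℕ} (uhat : Site d) (x : Path d) :
    tau uhat x = ⊤ ↔ ∀ n, ¬ IsRegen uhat x n := by
  simp [tau, iInf_eq_top]

lemma tau_eq_coe_iff {d : ℕ} (uhat : Site d) (x : Path d) (n : ℕ) :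
    tau uhat x = n ↔ IsRegen uhat x n ∧ ∀ m < n, ¬ IsRegen uhat x m := by
  have hle : ∀ k, IsRegen uhat x k → tau uhat x ≤ k := fun k hk => iInf₂_le k hk
  have hge : ∀ n : ℕ, IsRegen uhat x n → (∀ m < n, ¬ IsRegen uhat x m) → tau uhat x = n :=
    fun n h h' => le_antisymm (hle n h) (le_iInf₂ fun m hm => by
      by_contra hlt
      exact h' m (by exact_mod_cast not_le.1 hlt) hm)
  constructor
  · intro h
    have hex : ∃ k, IsRegen uhat x k := by
      by_contra hne
      rw [(tau_eq_top_iff uhat x).2 (not_exists.1 hne)] at h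
      exact ENat.natCast_ne_top n h.symm
    classical
    have := hge _ (Nat.find_spec hex) (fun m hm => Nat.find_min hex hm)
    obtain rfl : n = Nat.find hex := by exact_mod_cast h.symm.trans this
    exact ⟨Nat.find_spec hex, fun m hm => Nat.find_min hex hm⟩
  · rintro ⟨h, h'⟩
    exact hge n h h'

lemma IsRegen.tau_le {d : ℕ} {uhat : Site d} {x : Path d} {n : ℕ} (h : IsRegen uhat x n) :
    tau uhat x ≤ n := iInf₂_le n h

lemma isRegen_toNat_tau {d : ℕ} {uhat : Site d} {x : Path d} (h : tau uhat x ≠ ⊤) :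
    IsRegen uhat x (tau uhat x).toNat :=
  ((tau_eq_coe_iff uhat x _).1 (ENat.natCast_toNat h).symm).1

lemma measurableSet_isRegen {d : ℕ} (uhat : Site d) (n : ℕ) :
    MeasurableSet {x : Path d | IsRegen uhat x n} := by
  simp only [IsRegen, Set.ofPred_and, Set.ofPred_forall]
  refine MeasurableSet.inter (MeasurableSet.const _) (MeasurableSet.inter ?_ ?_)
  · exact MeasurableSet.iInter fun m => MeasurableSet.iInter fun _ =>
      measurableSet_lt (measurable_level _ _) (measurable_level _ _)
  · exact MeasurableSet.iInter fun m => MeasurableSet.iInter fun _ =>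
      measurableSet_le (measurable_level _ _) (measurable_level _ _)

lemma measurable_tau {d : ℕ} (uhat : Site d) : Measurable (tau uhat : Path d → ℕ∞) := by
  refine ENat.measurable_iff.2 fun n => ?_
  have : tau uhat ⁻¹' {(n : ℕ∞)} =
      {x | IsRegen uhat x n} ∩ ⋂ m, ⋂ (_ : m < n), {x | IsRegen uhat x m}ᶜ := by
    ext x
    simp [tau_eq_coe_iff]
  rw [this]
  exact (measurableSet_isRegen uhat n).inter (MeasurableSet.iInter fun m =>
    MeasurableSet.iInter fun _ => (measurableSet_isRegen uhat m).compl)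

lemma measurable_toNat_tau {d : ℕ} (uhat : Site d) :
    Measurable fun x : Path d => (tau uhat x).toNat :=
  (Measurable.of_discrete (f := ENat.toNat)).comp (measurable_tau uhat)

lemma measurable_tauReal {d : ℕ} (uhat : Site d) : Measurable (tauReal uhat : Path d → ℝ) :=
  (Measurable.of_discrete (f := fun n : ℕ => (n : ℝ))).comp (measurable_toNat_tau uhat)

lemma measurable_posTau {d : ℕ} (uhat : Site d) :
    Measurable (posTau uhat : Path d → EuclideanSpace ℝ (Fin d)) := by
  refine (measurable_of_countable (toVec : Site d → _)).comp ?_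
  have : Measurable fun q : Path d × ℕ => q.1 q.2 :=
    measurable_from_prod_countable_left fun n => measurable_pi_apply n
  exact this.comp (measurable_id.prodMk (measurable_toNat_tau uhat))

/-! ### Steps of the averaged walk -/

lemma toVec_add {d : ℕ} (x y : Site d) : toVec (x + y) = toVec x + toVec y := by
  ext i; simp [toVec]

lemma toVec_zero {d : ℕ} : toVec (0 : Site d) = 0 := by
  ext i; simp [toVec]

lemma PosPath.meanJump_pos {d : ℕ} {μ : Measure (ProbVec d)} [IsProbabilityMeasure μ] {n : ℕ}
    {w : Path d} (h : PosPath μ n w) {i : ℕ} (hi : i < n) : 0 < meanJump μ (w (i + 1) - w i) := by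
  rw [meanJump_pos_iff]
  have hm : MeasurableSet {p : ProbVec d | 0 < p.1 (w (i + 1) - w i)} :=
    measurableSet_lt measurable_const ((measurable_pi_apply _).comp measurable_subtype_coe)
  rw [← Measure.infinitePi_map_eval (fun _ : Site d => μ) (w i),
    Measure.map_apply (measurable_pi_apply (w i)) hm]
  exact fun h0 => h (measure_mono_null (fun ω hω => hω i hi) h0)

lemma ae_steps {d : ℕ} (μ : Measure (ProbVec d)) [IsProbabilityMeasure μ] (a : Site d) :
    ∀ᵐ x ∂(averaged μ a), x 0 = a ∧ ∀ n, 0 < meanJump μ (x (n + 1) - x n) := by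
  filter_upwards [ae_cyl_ne_zero (averaged μ a)] with x hx
  exact ⟨((averaged_cyl_ne_zero_iff μ a 0 x).1 (hx 0)).1, fun n =>
    ((averaged_cyl_ne_zero_iff μ a (n + 1) x).1 (hx (n + 1))).2.meanJump_pos n.lt_succ_self⟩

lemma BoundedSteps.exists_norm_le {d : ℕ} {μ : Measure (ProbVec d)} [IsProbabilityMeasure μ]
    (h : BoundedSteps μ) : ∃ M : ℝ, 0 < M ∧ ∀ z, 0 < meanJump μ z → ‖toVec z‖ ≤ M := by
  obtain ⟨M, hM, h⟩ := h
  refine ⟨M, hM, fun z hz => ?_⟩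
  by_contra hlt
  rw [meanJump, integral_eq_zero_of_ae (h z (not_le.1 hlt))] at hz
  exact lt_irrefl _ hz

lemma norm_toVec_le_of_steps {d : ℕ} {M : ℝ} {x : Path d} (h0 : x 0 = 0)
    (h : ∀ n, ‖toVec (x (n + 1) - x n)‖ ≤ M) (n : ℕ) : ‖toVec (x n)‖ ≤ M * n := by
  induction n with
  | zero => simp [h0, toVec_zero]
  | succ n ih =>
    have : toVec (x (n + 1)) = toVec (x (n + 1) - x n) + toVec (x n) := by
      rw [← toVec_add, sub_add_cancel]
    rw [this]
    refine (norm_add_le _ _).trans ?_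
    have := h n
    push_cast
    linarith

/-! ### Moments -/

lemma Regular.pos_dim {d : ℕ} {μ : Measure (ProbVec d)} [IsProbabilityMeasure μ]
    (h : Regular μ) : 1 ≤ d := by
  rcases Nat.eq_zero_or_pos d with rfl | hd
  · exact absurd (fun y _ => ⟨0, Subsingleton.elim _ _⟩) (h.1 0)
  · exact hd

/-- For `d ≥ 1` the given exponent exceeds `2`, and `τ₁ ≥ 1` makes powers monotone in the exponent.
The argument needs only this second moment. -/
lemma MomentHyp.lintegral_sq_lt_top {d : ℕ} {μ : Measure (ProbVec d)} [IsProbabilityMeasure μ]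
    {uhat : Site d} (h : MomentHyp μ uhat) (hd : 1 ≤ d) :
    ∫⁻ x, ((tau uhat x : ℕ∞) : ℝ≥0∞) ^ (2 : ℝ) ∂(averaged μ 0) < ∞ := by
  obtain ⟨p, hp, h⟩ := h
  have hd' : (1 : ℝ) ≤ d := by exact_mod_cast hd
  refine (lintegral_mono fun x => ?_).trans_lt h
  have h1 : (1 : ℝ≥0∞) ≤ ((tau uhat x : ℕ∞) : ℝ≥0∞) := by
    have : (1 : ℕ∞) ≤ tau uhat x := le_iInf₂ fun n hn => by exact_mod_cast hn.1
    exact_mod_cast this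
  exact ENNReal.rpow_le_rpow_of_exponent_le h1 (by linarith)

lemma ae_tau_ne_top {d : ℕ} {μ : Measure (ProbVec d)} [IsProbabilityMeasure μ]
    {uhat : Site d} (h : MomentHyp μ uhat) (hd : 1 ≤ d) :
    ∀ᵐ x ∂(averaged μ 0), tau uhat x ≠ ⊤ := by
  have hm : Measurable fun x : Path d => ((tau uhat x : ℕ∞) : ℝ≥0∞) ^ (2 : ℝ) :=
    (Measurable.of_discrete (f := fun n : ℕ∞ => (n : ℝ≥0∞) ^ (2 : ℝ))).comp (measurable_tau uhat)
  filter_upwards [ae_lt_top hm (h.lintegral_sq_lt_top hd).ne] with x hx htop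
  simp [htop] at hx

lemma memLp_tauReal {d : ℕ} {μ : Measure (ProbVec d)} [IsProbabilityMeasure μ]
    {uhat : Site d} (h : MomentHyp μ uhat) (hd : 1 ≤ d) :
    MemLp (tauReal uhat) 2 (averaged μ 0) := by
  refine ⟨(measurable_tauReal uhat).aestronglyMeasurable, ?_⟩
  rw [eLpNorm_lt_top_iff_lintegral_rpow_enorm_lt_top two_ne_zero ENNReal.ofNat_ne_top]
  refine (lintegral_mono_ae ?_).trans_lt (h.lintegral_sq_lt_top hd)
  filter_upwards [ae_tau_ne_top h hd] with x hx
  have : ‖tauReal uhat x‖ₑ = ((tau uhat x : ℕ∞) : ℝ≥0∞) := by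
    conv_rhs => rw [← ENat.natCast_toNat hx]
    simp [tauReal]
  rw [this]
  simp

/-- Bounded steps give `‖X_{τ₁}‖ ≤ M τ₁`. -/
lemma memLp_posTau {d : ℕ} {μ : Measure (ProbVec d)} [IsProbabilityMeasure μ]
    {uhat : Site d} (h : MomentHyp μ uhat) (hd : 1 ≤ d) (hS : BoundedSteps μ) :
    MemLp (posTau uhat) 2 (averaged μ 0) := by
  obtain ⟨M, hM, hS⟩ := hS.exists_norm_le
  refine MemLp.of_le_mul (c := M) (memLp_tauReal h hd)
    (measurable_posTau uhat).aestronglyMeasurable ?_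
  filter_upwards [ae_steps μ 0] with x hx
  rw [tauReal, Real.norm_of_nonneg (Nat.cast_nonneg _)]
  exact norm_toVec_le_of_steps hx.1 (fun n => hS _ (hx.2 n)) _

/-! ### The walk conditioned not to backtrack -/

/-- Otherwise almost every environment gives probability zero to staying above any starting site, so
by the Markov property the walk almost surely goes back below its level after each time. This
contradicts the regeneration at the finite time `τ₁`. -/
lemma averaged_stay_ne_zero {d : ℕ} {μ : Measure (ProbVec d)} [IsProbabilityMeasure μ]
    {uhat : Site d} (h : ∀ᵐ x ∂(averaged μ 0), tau uhat x ≠ ⊤) :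
    averaged μ 0 (stay uhat) ≠ 0 := by
  intro h0
  have hq : ∀ᵐ ω ∂(envLaw μ), ∀ a, quenched a ω (stay uhat) = 0 := ae_all_iff.2 fun a =>
    (averaged_eq_zero_iff μ a (measurableSet_stay uhat)).1 ((averaged_stay μ uhat a).trans h0)
  have hshift : ∀ n, averaged μ 0 (shiftPath n ⁻¹' stay uhat) = 0 := fun n => by
    rw [averaged_eq_zero_iff μ 0 (measurable_shiftPath n (measurableSet_stay uhat))]
    filter_upwards [hq] with ω hω
    refine measure_eq_zero_of_forall_cyl _ n _ fun w => ?_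
    rw [quenched_markov _ _ _ _ (measurableSet_stay uhat), hω, mul_zero]
  have hae : ∀ᵐ x ∂(averaged μ 0), ∀ n, shiftPath n x ∉ stay uhat :=
    ae_all_iff.2 fun n => measure_eq_zero_iff_ae_notMem.1 (hshift n)
  obtain ⟨x, hx, hx'⟩ := (h.and hae).exists
  refine hx' (tau uhat x).toNat fun m => ?_
  exact (isRegen_toNat_tau hx).2.2 _ (Nat.le_add_right _ _)

lemma regenLaw_eq {d : ℕ} (μ : Measure (ProbVec d)) [IsProbabilityMeasure μ] (uhat : Site d) :
    regenLaw μ uhat = ProbabilityTheory.cond (averaged μ 0) (stay uhat) := by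
  rw [regenLaw]
  congr 1
  ext x
  exact backtrack_eq_top_iff uhat x

lemma isProbabilityMeasure_regenLaw {d : ℕ} {μ : Measure (ProbVec d)} [IsProbabilityMeasure μ]
    {uhat : Site d} (h : averaged μ 0 (stay uhat) ≠ 0) :
    IsProbabilityMeasure (regenLaw μ uhat) := by
  rw [regenLaw_eq]
  exact cond_isProbabilityMeasure h

lemma regenLaw_absolutelyContinuous {d : ℕ} (μ : Measure (ProbVec d)) [IsProbabilityMeasure μ]
    (uhat : Site d) : regenLaw μ uhat ≪ averaged μ 0 :=
  cond_absolutelyContinuous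

lemma memLp_regenLaw {d : ℕ} {μ : Measure (ProbVec d)} [IsProbabilityMeasure μ]
    {uhat : Site d} {E : Type*} [NormedAddCommGroup E] {f : Path d → E} {p : ℝ≥0∞}
    (hstay : averaged μ 0 (stay uhat) ≠ 0) (h : MemLp f p (averaged μ 0)) :
    MemLp f p (regenLaw μ uhat) := by
  rw [regenLaw_eq]
  exact (h.restrict _).smul_measure (ENNReal.inv_ne_top.2 hstay)

lemma ae_averaged_of_ae_regenLaw {d : ℕ} {μ : Measure (ProbVec d)} [IsProbabilityMeasure μ]
    {uhat : Site d} {q : Path d → Prop} (h : ∀ᵐ x ∂(regenLaw μ uhat), q x) :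
    ∀ᵐ x ∂(averaged μ 0), x ∈ stay uhat → q x := by
  rw [regenLaw_eq, ProbabilityTheory.cond, Measure.ae_ennreal_smul_measure_iff
    (ENNReal.inv_ne_zero.2 (measure_ne_top _ _))] at h
  exact (ae_restrict_iff' (measurableSet_stay uhat)).1 h

/-- The walk conditioned not to backtrack has square integrable regeneration data. -/
structure RegenSquareIntegrable {d : ℕ} (μ : Measure (ProbVec d)) [IsProbabilityMeasure μ]
    (uhat : Site d) : Prop where
  stay_ne_zero : averaged μ 0 (stay uhat) ≠ 0
  ae_tau : ∀ᵐ x ∂(averaged μ 0), tau uhat x ≠ ⊤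
  tau : MemLp (tauReal uhat) 2 (regenLaw μ uhat)
  pos : MemLp (posTau uhat) 2 (regenLaw μ uhat)

lemma regenSquareIntegrable {d : ℕ} {μ : Measure (ProbVec d)} [IsProbabilityMeasure μ]
    {uhat : Site d} (h : MomentHyp μ uhat) (hd : 1 ≤ d) (hS : BoundedSteps μ) :
    RegenSquareIntegrable μ uhat :=
  have hs := averaged_stay_ne_zero (ae_tau_ne_top h hd)
  ⟨hs, ae_tau_ne_top h hd, memLp_regenLaw hs (memLp_tauReal h hd),
    memLp_regenLaw hs (memLp_posTau h hd hS)⟩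

namespace RegenSquareIntegrable

variable {d : ℕ} {μ : Measure (ProbVec d)} [IsProbabilityMeasure μ] {uhat : Site d}

lemma meanTau_pos (h : RegenSquareIntegrable μ uhat) : 0 < meanTau μ uhat := by
  have := isProbabilityMeasure_regenLaw h.stay_ne_zero
  have h1 : (1 : ℝ) ≤ meanTau μ uhat := by
    have : ∫ _, (1 : ℝ) ∂(regenLaw μ uhat) ≤ meanTau μ uhat := by
      refine integral_mono_ae (integrable_const _) (h.tau.integrable one_le_two) ?_
      filter_upwards [(regenLaw_absolutelyContinuous μ uhat).ae_le h.ae_tau] with x hx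
      have := (isRegen_toNat_tau hx).1
      simp only [tauReal]
      exact_mod_cast this
    simpa using this
  linarith

lemma memLp_centered (h : RegenSquareIntegrable μ uhat) :
    MemLp (centered μ uhat) 2 (regenLaw μ uhat) := by
  have : MemLp (fun x => tauReal uhat x • velocity μ uhat) 2 (regenLaw μ uhat) := by
    refine MemLp.of_le_mul (c := ‖velocity μ uhat‖) h.tau
      ((measurable_tauReal uhat).smul_const _).aestronglyMeasurable (ae_of_all _ fun x => ?_)
    rw [norm_smul, mul_comm]
  exact h.pos.sub this

lemma memLp_centered_apply (h : RegenSquareIntegrable μ uhat) (i : Fin d) :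
    MemLp (fun x => centered μ uhat x i) 2 (regenLaw μ uhat) :=
  (EuclideanSpace.proj (𝕜 := ℝ) i : EuclideanSpace ℝ (Fin d) →L[ℝ] ℝ).comp_memLp'
    h.memLp_centered

lemma quadForm_diffusion (h : RegenSquareIntegrable μ uhat) (u : EuclideanSpace ℝ (Fin d)) :
    u.ofLp ⬝ᵥ (diffusion μ uhat *ᵥ u.ofLp) =
      (∫ x, (inner ℝ u (centered μ uhat x)) ^ 2 ∂(regenLaw μ uhat)) / meanTau μ uhat := by
  have hint : ∀ i j : Fin d, Integrable
      (fun x => (centered μ uhat x i * centered μ uhat x j) * (u i * u j)) (regenLaw μ uhat) :=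
    fun i j => ((h.memLp_centered_apply i).integrable_mul (h.memLp_centered_apply j)).mul_const _
  have hexp : ∀ x, (inner ℝ u (centered μ uhat x)) ^ 2 =
      ∑ i, ∑ j, (centered μ uhat x i * centered μ uhat x j) * (u i * u j) := fun x => by
    rw [PiLp.inner_apply, sq, Finset.sum_mul_sum]
    refine Finset.sum_congr rfl fun i _ => Finset.sum_congr rfl fun j _ => ?_
    simp only [RCLike.inner_apply, conj_trivial]
    ring
  simp_rw [hexp]
  rw [integral_finsetSum _ fun i _ => integrable_finsetSum _ fun j _ => hint i j, Finset.sum_div]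
  simp only [dotProduct, Matrix.mulVec, Finset.mul_sum]
  refine Finset.sum_congr rfl fun i _ => ?_
  rw [integral_finsetSum _ fun j _ => hint i j, Finset.sum_div]
  refine Finset.sum_congr rfl fun j _ => ?_
  rw [integral_mul_const]
  simp only [diffusion, Matrix.of_apply]
  ring

lemma integrable_inner_sq (h : RegenSquareIntegrable μ uhat) (u : EuclideanSpace ℝ (Fin d)) :
    Integrable (fun x => (inner ℝ u (centered μ uhat x)) ^ 2) (regenLaw μ uhat) :=
  MemLp.integrable_sq (h.memLp_centered.const_inner u)

/-- A nonnegative function with zero integral vanishes almost everywhere. Degeneracy of the matrix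
thus becomes a pathwise identity. -/
lemma quadForm_eq_zero_iff (h : RegenSquareIntegrable μ uhat) (u : EuclideanSpace ℝ (Fin d)) :
    u.ofLp ⬝ᵥ (diffusion μ uhat *ᵥ u.ofLp) = 0 ↔
      ∀ᵐ x ∂(regenLaw μ uhat),
        inner ℝ u (posTau uhat x) = tauReal uhat x * inner ℝ u (velocity μ uhat) := by
  rw [h.quadForm_diffusion u, div_eq_zero_iff, or_iff_left h.meanTau_pos.ne',
    integral_eq_zero_iff_of_nonneg (fun x => sq_nonneg _) (h.integrable_inner_sq u)]
  refine eventually_congr (Eventually.of_forall fun x => ?_)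
  simp [centered, inner_sub_right, inner_smul_right, sub_eq_zero]

/-- If every admissible step has the same component along `u`, then the increment at the first
regeneration is deterministic along `u`. -/
lemma inner_posTau_of_forall_step (h : RegenSquareIntegrable μ uhat)
    {u : EuclideanSpace ℝ (Fin d)} {c : ℝ}
    (hc : ∀ z, 0 < meanJump μ z → inner ℝ u (toVec z) = c) :
    ∀ᵐ x ∂(regenLaw μ uhat),
      inner ℝ u (posTau uhat x) = tauReal uhat x * inner ℝ u (velocity μ uhat) := by
  have hpos : ∀ᵐ x ∂(regenLaw μ uhat), inner ℝ u (posTau uhat x) = tauReal uhat x * c := by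
    filter_upwards [(regenLaw_absolutelyContinuous μ uhat).ae_le (ae_steps μ 0)] with x hx
    have : ∀ n : ℕ, inner ℝ u (toVec (x n)) = n * c := by
      intro n
      induction n with
      | zero => simp [hx.1, toVec_zero]
      | succ n ih =>
        have e : toVec (x (n + 1)) = toVec (x (n + 1) - x n) + toVec (x n) := by
          rw [← toVec_add, sub_add_cancel]
        rw [e, inner_add_right, ih, hc _ (hx.2 n)]
        push_cast; ring
    exact this _
  have hv : inner ℝ u (velocity μ uhat) = c := by
    have := isProbabilityMeasure_regenLaw h.stay_ne_zero
    rw [velocity, inner_smul_right, ← integral_inner (h.pos.integrable one_le_two),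
      integral_congr_ae hpos, integral_mul_const, ← meanTau, inv_mul_cancel_left₀ h.meanTau_pos.ne']
  rw [hv]
  exact hpos

end RegenSquareIntegrable

/-! ### Deterministic regeneration cycles -/

/-- If the displacement along `u` of the conditioned walk at its first regeneration time is
`c τ₁`, then the same relation holds for every possible finite path that stays above its starting
point and below its endpoint. -/
theorem inner_displacement_of_posPath {d : ℕ} {μ : Measure (ProbVec d)} [IsProbabilityMeasure μ]
    {uhat : Site d} (hstay : averaged μ 0 (stay uhat) ≠ 0)
    (htau : ∀ᵐ x ∂(averaged μ 0), tau uhat x ≠ ⊤) {u : EuclideanSpace ℝ (Fin d)} {c : ℝ}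
    (hu : ∀ᵐ x ∂(averaged μ 0), x ∈ stay uhat → inner ℝ u (posTau uhat x) = tauReal uhat x * c)
    (n : ℕ) (w : Path d) (hw : PosPath μ n w) (hge : ∀ i ≤ n, w 0 ⬝ᵥ uhat ≤ w i ⬝ᵥ uhat)
    (hlt : ∀ i < n, w i ⬝ᵥ uhat < w n ⬝ᵥ uhat) :
    inner ℝ u (toVec (w n - w 0)) = n * c := by
  induction n using Nat.strong_induction_on generalizing w with
  | _ n ih =>
    rcases Nat.eq_zero_or_pos n with rfl | hn
    · simp [toVec_zero]
    have hE := averaged_cyl_inter_stay_ne_zero hstay hw hlt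
    rw [← map_translatePath_averaged, Measure.map_apply (measurable_translatePath _)
      ((measurableSet_cyl n w).inter (measurable_shiftPath n (measurableSet_stay uhat)))] at hE
    -- An event of positive probability contains a path with all the almost sure properties; from
    -- here on the argument is about this single path.
    obtain ⟨x, ⟨hxc, hxs⟩, hx⟩ : ∃ x ∈ translatePath (w 0) ⁻¹' (cyl n w ∩ shiftPath n ⁻¹' stay uhat),
        tau uhat x ≠ ⊤ ∧ (x ∈ stay uhat → inner ℝ u (posTau uhat x) = tauReal uhat x * c) := by
      by_contra hne
      push Not at hne
      refine hE (measure_mono_null (fun x hx => ?_) (ae_iff.1 (htau.and hu)))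
      rintro ⟨h1, h2⟩
      exact (hne x hx h1).2 (h2 (hne x hx h1).1)
    have hxw : ∀ i ≤ n, x i + w 0 = w i := hxc
    have hlev : ∀ i ≤ n, x i ⬝ᵥ uhat + w 0 ⬝ᵥ uhat = w i ⬝ᵥ uhat := fun i hi => by
      rw [← add_dotProduct, hxw i hi]
    have hafter : ∀ m ≥ n, x n ⬝ᵥ uhat ≤ x m ⬝ᵥ uhat := fun m hm => by
      have := hxs (m - n)
      simp only [shiftPath, translatePath, add_dotProduct, add_zero, Nat.add_sub_cancel' hm] at this
      linarith
    have hxstay : x ∈ stay uhat := fun m => by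
      have h0 := hlev 0 (Nat.zero_le _)
      rcases le_total m n with hm | hm
      · have h1 := hlev m hm
        have h2 := hge m hm
        linarith
      · have h1 := hlev n le_rfl
        have h2 := hge n le_rfl
        have h3 := hafter m hm
        linarith
    have hreg : IsRegen uhat x n := ⟨hn, fun m hm => by
      have h1 := hlev m hm.le
      have h2 := hlev n le_rfl
      have h3 := hlt m hm
      linarith, hafter⟩
    have hk := isRegen_toNat_tau hx.1
    -- Time `n` is a regeneration of `x`, but perhaps not the first; let `k ≤ n` be the first.
    have hkn : (tau uhat x).toNat ≤ n := ENat.toNat_le_of_le_natCast hreg.tau_le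
    have huk := hx.2 hxstay
    simp only [posTau, tauReal] at huk
    generalize (tau uhat x).toNat = k at hk hkn huk
    obtain ⟨hk1, hk2, hk3⟩ := hk
    -- After a regeneration the path stays above its level, so the piece from `k` to `n` satisfies
    -- the same hypotheses; it is shorter since `k ≥ 1`.
    have hrest := ih (n - k) (by omega) (shiftPath k w) (hw.shift k)
      (fun i hi => by
        have h1 := hlev k hkn
        have h2 := hlev (k + i) (by omega)
        have h3 := hk3 (k + i) (by omega)
        simp only [shiftPath, add_zero]
        linarith)
      (fun i hi => by
        simp only [shiftPath, Nat.add_sub_cancel' hkn]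
        exact hlt _ (by omega))
    simp only [shiftPath, Nat.add_sub_cancel' hkn, add_zero] at hrest
    have hsplit : toVec (w n - w 0) = toVec (w n - w k) + toVec (x k) := by
      rw [← toVec_add]
      congr 1
      rw [← hxw k hkn]
      abel
    rw [hsplit, inner_add_right, hrest, huk, Nat.cast_sub hkn]
    ring

/-! ### Test paths given by lists of steps -/

/-- The successive pairs (site, step) of the path from `a` with the given list of steps. -/
def trace {d : ℕ} : Site d → List (Site d) → List (Site d × Site d)
  | _, [] => []
  | a, s :: l => (a, s) :: trace (a + s) l

@[simp] lemma trace_nil {d : ℕ} (a : Site d) : trace a [] = [] := rfl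

@[simp] lemma trace_cons {d : ℕ} (a s : Site d) (l : List (Site d)) :
    trace a (s :: l) = (a, s) :: trace (a + s) l := rfl

lemma trace_append {d : ℕ} (a : Site d) (l l' : List (Site d)) :
    trace a (l ++ l') = trace a l ++ trace (a + l.sum) l' := by
  induction l generalizing a with
  | nil => simp
  | cons s l ih => simp [ih, add_assoc]

lemma mem_trace_replicate {d : ℕ} {a z : Site d} {K : ℕ} {q : Site d × Site d}
    (hq : q ∈ trace a (List.replicate K z)) : ∃ j < K, q = (a + j • z, z) := by
  induction K generalizing a with
  | zero => simp at hq
  | succ K ih =>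
    rw [List.replicate_succ, trace_cons, List.mem_cons] at hq
    rcases hq with rfl | hq
    · exact ⟨0, by omega, by simp⟩
    · obtain ⟨j, hj, rfl⟩ := ih hq
      exact ⟨j + 1, by omega, by rw [succ_nsmul', add_assoc]⟩

lemma mem_trace_take {d : ℕ} (a : Site d) (l : List (Site d)) {i : ℕ} (hi : i < l.length) :
    (a + (l.take i).sum, (l.take (i + 1)).sum - (l.take i).sum) ∈ trace a l := by
  induction l generalizing a i with
  | nil => simp at hi
  | cons s l ih =>
    rw [trace_cons, List.mem_cons]
    cases i with
    | zero => left; simp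
    | succ i =>
      right
      have := ih (a + s) (i := i) (by simpa using hi)
      simpa [add_assoc] using this

section Steps

variable {d : ℕ} {μ : Measure (ProbVec d)} [IsProbabilityMeasure μ] {uhat : Site d}
  {u : EuclideanSpace ℝ (Fin d)} {c : ℝ}

/-- Every possible finite path from the origin that stays above its starting point and below its
endpoint has a displacement along `u` equal to `c` times its length. -/
def CycleRelation (μ : Measure (ProbVec d)) (uhat : Site d) (u : EuclideanSpace ℝ (Fin d))
    (c : ℝ) : Prop :=
  ∀ l : List (Site d), (∀ x, μ {p | ∀ q ∈ trace 0 l, q.1 = x → 0 < p.1 q.2} ≠ 0) →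
    (∀ q ∈ trace 0 l, 0 ≤ q.1 ⬝ᵥ uhat ∧ q.1 ⬝ᵥ uhat < l.sum ⬝ᵥ uhat) →
    inner ℝ u (toVec l.sum) = l.length * c

/-- Positions are the partial sums of the list, which translates the statement about paths into one
that suits explicit constructions. -/
lemma cycleRelation (hstay : averaged μ 0 (stay uhat) ≠ 0)
    (htau : ∀ᵐ x ∂(averaged μ 0), tau uhat x ≠ ⊤)
    (hu : ∀ᵐ x ∂(averaged μ 0), x ∈ stay uhat → inner ℝ u (posTau uhat x) = tauReal uhat x * c) :
    CycleRelation μ uhat u c := by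
  intro l hpos hlev
  have hmem := fun i (hi : i < l.length) => mem_trace_take 0 l hi
  simp only [zero_add] at hmem
  have := inner_displacement_of_posPath hstay htau hu l.length (fun i => (l.take i).sum)
    (posPath_of_forall_site fun x h0 => by
      refine hpos x (measure_mono_null ?_ h0)
      intro p hp i hi hx
      rw [← hx]
      exact hp _ (hmem i hi) hx)
    (fun i hi => by
      simp only [List.take_zero, List.sum_nil, zero_dotProduct]
      rcases hi.lt_or_eq with hi | rfl
      · exact (hlev _ (hmem i hi)).1
      -- The endpoint is not recorded in the trace; it lies above the first site, which is.
      · rcases l with _ | ⟨s, l⟩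
        · simp
        · have := hlev _ (hmem 0 (by simp))
          rw [List.take_length]
          exact this.1.trans this.2.le)
    (fun i hi => by
      rw [List.take_length]
      exact (hlev _ (hmem i hi)).2)
  simpa using this

/-- Joint possibility of the steps of a path that visits only the site `A` several times with
different steps. -/
lemma forall_site_ne_zero {A s : Site d} {r : ℕ} {T : List (Site d × Site d)}
    (hA : μ {p | 0 < p.1 s ∧ (r ≠ 0 → 0 < p.1 0)} ≠ 0)
    (hTA : ∀ q ∈ T, q.1 = A → q.2 = s ∨ r ≠ 0 ∧ q.2 = 0)
    (hTT : ∀ q ∈ T, ∀ q' ∈ T, q.1 ≠ A → q.1 = q'.1 → q.2 = q'.2)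
    (hT : ∀ q ∈ T, μ {p | 0 < p.1 q.2} ≠ 0) (x : Site d) :
    μ {p | ∀ q ∈ T, q.1 = x → 0 < p.1 q.2} ≠ 0 := by
  -- Joint possibility is required only at `A`, where the guard `r ≠ 0` drops idling if none occurs;
  -- at any other visited site only one step is taken.
  by_cases hx : x = A
  · subst hx
    refine fun h0 => hA (measure_mono_null ?_ h0)
    rintro p ⟨hp1, hp2⟩ q hq hqx
    rcases hTA q hq hqx with h | ⟨hr, h⟩
    · rw [h]; exact hp1
    · rw [h]; exact hp2 hr
  · by_cases hex : ∃ q ∈ T, q.1 = x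
    · obtain ⟨q, hq, rfl⟩ := hex
      refine fun h0 => hT q hq (measure_mono_null ?_ h0)
      intro p hp q' hq' hqq
      rw [← hTT q hq q' hq' hx hqq.symm]
      exact hp
    · have : {p : ProbVec d | ∀ q ∈ T, q.1 = x → 0 < p.1 q.2} = Set.univ :=
        Set.eq_univ_of_forall fun p q hq hqx => absurd ⟨q, hq, hqx⟩ hex
      rw [this, measure_univ]
      exact one_ne_zero

lemma nsmul_dotProduct (n : ℕ) (z w : Site d) : (n • z) ⬝ᵥ w = n * (z ⬝ᵥ w) := by
  rw [smul_dotProduct, nsmul_eq_mul]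

lemma toVec_nsmul (n : ℕ) (z : Site d) : toVec (n • z) = (n : ℝ) • toVec z := by
  ext i; simp [toVec]

/-- A jump `s`, preceded by `r` idle steps, that cannot be undone by repeating the upward step
`z₀`. -/
lemma CycleRelation.jump_transverse (hC : CycleRelation μ uhat u c) {z₀ s : Site d} {r : ℕ}
    (hz₀ : μ {p | 0 < p.1 z₀} ≠ 0) (hup : 0 < z₀ ⬝ᵥ uhat)
    (hs : μ {p | 0 < p.1 s ∧ (r ≠ 0 → 0 < p.1 0)} ≠ 0) (hne : ∀ j : ℕ, s + j • z₀ ≠ 0) :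
    ∃ k : ℕ, k * inner ℝ u (toVec z₀) + inner ℝ u (toVec s) = (k + r + 1) * c := by
  -- Levels are integers, so `z₀·û ≥ 1`, and `K` steps `z₀` climb by more than `|s·û|`. Hence the
  -- jump `s` goes neither below the start nor above the final level.
  let K : ℕ := (s ⬝ᵥ uhat).natAbs + 1
  have hK : |s ⬝ᵥ uhat| + 1 ≤ K * (z₀ ⬝ᵥ uhat) := by
    have : (K : ℤ) = |s ⬝ᵥ uhat| + 1 := by simp [K]
    rw [← this]
    nlinarith
  have habs := neg_abs_le (s ⬝ᵥ uhat)
  let l := List.replicate K z₀ ++ (List.replicate r 0 ++ s :: List.replicate K z₀)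
  have hsum : l.sum = (K + K) • z₀ + s := by
    simp only [l, List.sum_append, List.sum_replicate, List.sum_cons, smul_zero, add_nsmul]
    abel
  have hlen : l.length = K + K + r + 1 := by
    simp only [l, List.length_append, List.length_replicate, List.length_cons]; omega
  have hT : ∀ q ∈ trace 0 l, (∃ j < K, q = (j • z₀, z₀)) ∨ (r ≠ 0 ∧ q = (K • z₀, 0)) ∨
      q = (K • z₀, s) ∨ ∃ j < K, q = (K • z₀ + (s + j • z₀), z₀) := by
    intro q hq
    simp only [l, trace_append, trace_cons, List.mem_append, List.mem_cons, List.sum_replicate,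
      smul_zero, zero_add, add_zero] at hq
    rcases hq with hq | hq | hq | hq
    · obtain ⟨j, hj, rfl⟩ := mem_trace_replicate hq
      exact Or.inl ⟨j, hj, by simp⟩
    · obtain ⟨j, hj, rfl⟩ := mem_trace_replicate hq
      exact Or.inr (Or.inl ⟨by omega, by simp⟩)
    · exact Or.inr (Or.inr (Or.inl hq))
    · obtain ⟨j, hj, rfl⟩ := mem_trace_replicate hq
      exact Or.inr (Or.inr (Or.inr ⟨j, hj, by rw [add_assoc]⟩))
  have hs1 : μ {p | 0 < p.1 s} ≠ 0 := fun h0 => hs (measure_mono_null (fun p hp => hp.1) h0)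
  have hs0 : r ≠ 0 → μ {p | 0 < p.1 0} ≠ 0 := fun hr h0 =>
    hs (measure_mono_null (fun p hp => hp.2 hr) h0)
  have hmain := hC l (forall_site_ne_zero (A := K • z₀) hs ?_ ?_ ?_) ?_
  · refine ⟨K + K, ?_⟩
    rw [hsum, hlen, toVec_add, toVec_nsmul, inner_add_right, inner_smul_right] at hmain
    rw [hmain]; push_cast; ring
  · intro q hq hqA
    rcases hT q hq with ⟨j, hj, rfl⟩ | ⟨hr, rfl⟩ | rfl | ⟨j, hj, rfl⟩
    · have := congrArg (· ⬝ᵥ uhat) hqA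
      simp only [nsmul_dotProduct] at this
      have := mul_right_cancel₀ hup.ne' this
      omega
    · exact Or.inr ⟨hr, rfl⟩
    · exact Or.inl rfl
    -- The last run returns to the site of the jump only if `s + j • z₀ = 0`. Other revisited sites
    -- are harmless, because every step off that site is `z₀`.
    · exact absurd (add_eq_left.1 hqA) (hne j)
  · have hz : ∀ q ∈ trace 0 l, q.1 ≠ K • z₀ → q.2 = z₀ := by
      intro q hq hqA
      rcases hT q hq with ⟨j, hj, rfl⟩ | ⟨hr, rfl⟩ | rfl | ⟨j, hj, rfl⟩
      · rfl
      · exact absurd rfl hqA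
      · exact absurd rfl hqA
      · rfl
    intro q hq q' hq' hqA hqq
    rw [hz q hq hqA, hz q' hq' (hqq ▸ hqA)]
  · intro q hq
    rcases hT q hq with ⟨j, hj, rfl⟩ | ⟨hr, rfl⟩ | rfl | ⟨j, hj, rfl⟩
    · exact hz₀
    · exact hs0 hr
    · exact hs1
    · exact hz₀
  · intro q hq
    have habs' := le_abs_self (s ⬝ᵥ uhat)
    rcases hT q hq with ⟨j, hj, rfl⟩ | ⟨hr, rfl⟩ | rfl | ⟨j, hj, rfl⟩ <;>
      simp only [hsum, add_dotProduct, nsmul_dotProduct, Nat.cast_add, add_mul]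
    · have h1 : (j : ℤ) * (z₀ ⬝ᵥ uhat) < K * (z₀ ⬝ᵥ uhat) :=
        mul_lt_mul_of_pos_right (by exact_mod_cast hj) hup
      have h2 : 0 ≤ (j : ℤ) * (z₀ ⬝ᵥ uhat) := by positivity
      constructor <;> linarith
    · have := abs_nonneg (s ⬝ᵥ uhat)
      constructor <;> linarith
    · have := abs_nonneg (s ⬝ᵥ uhat)
      constructor <;> linarith
    · have h1 : (j : ℤ) * (z₀ ⬝ᵥ uhat) < K * (z₀ ⬝ᵥ uhat) :=
        mul_lt_mul_of_pos_right (by exact_mod_cast hj) hup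
      have h2 : 0 ≤ (j : ℤ) * (z₀ ⬝ᵥ uhat) := by positivity
      constructor <;> linarith

/-- A jump `s`, preceded by `r` idle steps, that is invisible to a functional which vanishes at the
upward step `z₀` but not at the step `y`. -/
lemma CycleRelation.jump_parallel (hC : CycleRelation μ uhat u c) {z₀ y s : Site d} {r : ℕ}
    (hz₀ : μ {p | 0 < p.1 z₀} ≠ 0) (hup : 0 < z₀ ⬝ᵥ uhat) (hy : μ {p | 0 < p.1 y} ≠ 0)
    (hs : μ {p | 0 < p.1 s ∧ (r ≠ 0 → 0 < p.1 0)} ≠ 0) (hs0 : s ≠ 0) (φ : Site d →+ ℤ)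
    (hφz₀ : φ z₀ = 0) (hφy : φ y ≠ 0) (hφs : φ s = 0) :
    ∃ k : ℕ, k * inner ℝ u (toVec z₀) + 2 * inner ℝ u (toVec y) + inner ℝ u (toVec s) =
      (k + r + 3) * c := by
  let K : ℕ := 2 * (y ⬝ᵥ uhat).natAbs + (s ⬝ᵥ uhat).natAbs + 1
  have hK : 2 * |y ⬝ᵥ uhat| + |s ⬝ᵥ uhat| + 1 ≤ K * (z₀ ⬝ᵥ uhat) := by
    have : (K : ℤ) = 2 * |y ⬝ᵥ uhat| + |s ⬝ᵥ uhat| + 1 := by simp [K]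
    rw [← this]
    nlinarith
  have hs1 := neg_abs_le (s ⬝ᵥ uhat)
  have hs2 := le_abs_self (s ⬝ᵥ uhat)
  have hy1 := neg_abs_le (y ⬝ᵥ uhat)
  have hy2 := le_abs_self (y ⬝ᵥ uhat)
  have hs3 := abs_nonneg (s ⬝ᵥ uhat)
  have hy3 := abs_nonneg (y ⬝ᵥ uhat)
  let A := K • z₀ + y
  -- The two steps `y` lift the path through the values `0`, `φ y`, `2 φ y` of `φ`, so the climb,
  -- the jump and the final run occupy separate sites even when `s` points back along `z₀`.
  let l := List.replicate K z₀ ++ y :: (List.replicate r 0 ++ s :: y :: List.replicate K z₀)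
  have hsum : l.sum = (K + K) • z₀ + 2 • y + s := by
    simp only [l, List.sum_append, List.sum_replicate, List.sum_cons, smul_zero, add_nsmul,
      two_nsmul]
    abel
  have hlen : l.length = K + K + r + 3 := by
    simp only [l, List.length_append, List.length_replicate, List.length_cons]; omega
  have hT : ∀ q ∈ trace 0 l, (∃ j < K, q = (j • z₀, z₀)) ∨ q = (K • z₀, y) ∨
      (r ≠ 0 ∧ q = (A, 0)) ∨ q = (A, s) ∨ q = (A + s, y) ∨
      ∃ j < K, q = (A + s + y + j • z₀, z₀) := by
    intro q hq
    simp only [l, trace_append, trace_cons, List.mem_append, List.mem_cons, List.sum_replicate,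
      smul_zero, zero_add, add_zero] at hq
    rcases hq with hq | hq | hq | hq | hq | hq
    · obtain ⟨j, hj, rfl⟩ := mem_trace_replicate hq
      exact Or.inl ⟨j, hj, by simp⟩
    · exact Or.inr (Or.inl hq)
    · obtain ⟨j, hj, rfl⟩ := mem_trace_replicate hq
      exact Or.inr (Or.inr (Or.inl ⟨by omega, by simp [A]⟩))
    · exact Or.inr (Or.inr (Or.inr (Or.inl hq)))
    · exact Or.inr (Or.inr (Or.inr (Or.inr (Or.inl hq))))
    · exact Or.inr (Or.inr (Or.inr (Or.inr (Or.inr (mem_trace_replicate hq)))))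
  have hs1' : μ {p | 0 < p.1 s} ≠ 0 := fun h0 => hs (measure_mono_null (fun p hp => hp.1) h0)
  have hs0' : r ≠ 0 → μ {p | 0 < p.1 0} ≠ 0 := fun hr h0 =>
    hs (measure_mono_null (fun p hp => hp.2 hr) h0)
  have hφn : ∀ n : ℕ, φ (n • z₀) = 0 := fun n => by rw [map_nsmul, hφz₀, smul_zero]
  have hφA : φ A = φ y := by simp only [A, map_add, hφn, zero_add]
  have hmain := hC l (forall_site_ne_zero (A := A) hs ?_ ?_ ?_) ?_
  · refine ⟨K + K, ?_⟩
    rw [hsum, hlen, toVec_add, toVec_add, toVec_nsmul, toVec_nsmul, inner_add_right,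
      inner_add_right, inner_smul_right, inner_smul_right] at hmain
    push_cast at hmain ⊢
    rw [hmain]
  · intro q hq hqA
    have hφq := congrArg φ hqA
    rw [hφA] at hφq
    rcases hT q hq with ⟨j, hj, rfl⟩ | rfl | ⟨hr, rfl⟩ | rfl | rfl | ⟨j, hj, rfl⟩
    · simp only [hφn] at hφq
      exact absurd hφq.symm hφy
    · simp only [hφn] at hφq
      exact absurd hφq.symm hφy
    · exact Or.inr ⟨hr, rfl⟩
    · exact Or.inl rfl
    · exact absurd (add_eq_left.1 hqA) hs0
    · simp only [map_add, hφn, hφA, hφs] at hφq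
      omega
  · have hcase : ∀ q ∈ trace 0 l, q.1 ≠ A →
        (q.2 = z₀ ∧ (φ q.1 = 2 * φ y ∨ φ q.1 = 0 ∧ q.1 ⬝ᵥ uhat < (K • z₀) ⬝ᵥ uhat)) ∨
        (q.2 = y ∧ (φ q.1 = φ y ∨ q.1 = K • z₀)) := by
      intro q hq hqA
      rcases hT q hq with ⟨j, hj, rfl⟩ | rfl | ⟨hr, rfl⟩ | rfl | rfl | ⟨j, hj, rfl⟩
      · refine Or.inl ⟨rfl, Or.inr ⟨hφn j, ?_⟩⟩
        simp only [nsmul_dotProduct]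
        exact mul_lt_mul_of_pos_right (by exact_mod_cast hj) hup
      · exact Or.inr ⟨rfl, Or.inr rfl⟩
      · exact absurd rfl hqA
      · exact absurd rfl hqA
      · exact Or.inr ⟨rfl, Or.inl (by simp [hφA, hφs])⟩
      · exact Or.inl ⟨rfl, Or.inl (by
          simp only [map_add, hφA, hφs, hφn, add_zero, two_mul])⟩
    -- Sites left by `z₀` and sites left by `y` are told apart by `φ`, except for `K • z₀` against
    -- the first climb, where the level decides.
    have hsep : ∀ x, (φ x = 2 * φ y ∨ φ x = 0 ∧ x ⬝ᵥ uhat < (K • z₀) ⬝ᵥ uhat) →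
        (φ x = φ y ∨ x = K • z₀) → False := by
      rintro x h1 (h2 | rfl)
      · omega
      · rcases h1 with h1 | h1
        · simp only [hφn] at h1
          omega
        · exact lt_irrefl _ h1.2
    intro q hq q' hq' hqA hqq
    rcases hcase q hq hqA with ⟨h1, h2⟩ | ⟨h1, h2⟩ <;>
      rcases hcase q' hq' (hqq ▸ hqA) with ⟨h1', h2'⟩ | ⟨h1', h2'⟩
    · rw [h1, h1']
    · exact (hsep _ h2 (hqq ▸ h2')).elim
    · exact (hsep _ h2' (hqq ▸ h2)).elim
    · rw [h1, h1']
  · intro q hq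
    rcases hT q hq with ⟨j, hj, rfl⟩ | rfl | ⟨hr, rfl⟩ | rfl | rfl | ⟨j, hj, rfl⟩
    · exact hz₀
    · exact hy
    · exact hs0' hr
    · exact hs1'
    · exact hy
    · exact hz₀
  · intro q hq
    rcases hT q hq with ⟨j, hj, rfl⟩ | rfl | ⟨hr, rfl⟩ | rfl | rfl | ⟨j, hj, rfl⟩ <;>
      simp only [hsum, A, add_dotProduct, nsmul_dotProduct, Nat.cast_add, add_mul, Nat.cast_ofNat]
    · have h1 : (j : ℤ) * (z₀ ⬝ᵥ uhat) < K * (z₀ ⬝ᵥ uhat) :=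
        mul_lt_mul_of_pos_right (by exact_mod_cast hj) hup
      have h2 : 0 ≤ (j : ℤ) * (z₀ ⬝ᵥ uhat) := by positivity
      constructor <;> linarith
    · constructor <;> linarith
    · constructor <;> linarith
    · constructor <;> linarith
    · constructor <;> linarith
    · have h1 : (j : ℤ) * (z₀ ⬝ᵥ uhat) < K * (z₀ ⬝ᵥ uhat) :=
        mul_lt_mul_of_pos_right (by exact_mod_cast hj) hup
      have h2 : 0 ≤ (j : ℤ) * (z₀ ⬝ᵥ uhat) := by positivity
      constructor <;> linarith

end Steps

/-! ### Consequences of transience and regularity -/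

section Assumptions

variable {d : ℕ} {μ : Measure (ProbVec d)} [IsProbabilityMeasure μ] {uhat : Site d}

lemma Transient.exists_upward_step (h : Transient μ uhat) :
    ∃ z, 0 < meanJump μ z ∧ 0 < z ⬝ᵥ uhat := by
  by_contra hne
  push Not at hne
  obtain ⟨x, hx, hx0, hstep⟩ := (Eventually.and h (ae_steps μ 0)).exists
  have hle : ∀ n, x n ⬝ᵥ uhat ≤ 0 := by
    intro n
    induction n with
    | zero => simp [hx0]
    | succ n ih =>
      have := hne _ (hstep n)
      rw [sub_dotProduct] at this
      linarith
  obtain ⟨n, hn⟩ := (hx.eventually (eventually_gt_atTop 0)).exists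
  exact absurd (hle n) (not_le.2 hn)

/-- A transient walk is almost never stuck at a site. -/
lemma Transient.ae_ne_one (h : Transient μ uhat) : ∀ᵐ p ∂μ, p.1 0 ≠ 1 := by
  -- Never leaving the origin contradicts transience, so it is null; in an environment with `π_{0,0}
  -- = 1` it would be certain.
  let D : Set (Path d) := {x | ∀ n, x n = 0}
  have hD : MeasurableSet D := by
    simp only [D, Set.ofPred_forall]
    exact MeasurableSet.iInter fun n => measurable_pi_apply n (measurableSet_singleton 0)
  have hD0 : averaged μ 0 D = 0 := by
    refine measure_mono_null (fun x hx => ?_) (ae_iff.1 h)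
    intro hlim
    obtain ⟨n, hn⟩ := (hlim.eventually (eventually_gt_atTop 0)).exists
    rw [hx n, zero_dotProduct] at hn
    exact lt_irrefl _ hn
  have hae : ∀ᵐ ω ∂(envLaw μ), (ω 0).1 0 ≠ 1 := by
    filter_upwards [(averaged_eq_zero_iff μ 0 hD).1 hD0] with ω hω h1
    have hjump : ∀ y, 0 < jumpProb ω 0 y → y = 0 := by
      intro y hy
      by_contra hy0
      have h2 := sum_le_hasSum {0, y} (fun z _ => (ω 0).2.1 z) (ω 0).2.2
      rw [Finset.sum_pair (Ne.symm hy0), h1] at h2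
      rw [jumpProb, sub_zero] at hy
      linarith
    have hDae : ∀ᵐ x ∂(quenched 0 ω), x ∈ D := by
      filter_upwards [ae_cyl_ne_zero (quenched 0 ω)] with x hx n
      induction n with
      | zero => exact ((quenched_cyl_ne_zero_iff 0 ω 0 x).1 (hx 0)).1
      | succ n ih =>
        have := ((quenched_cyl_ne_zero_iff 0 ω (n + 1) x).1 (hx (n + 1))).2 n n.lt_succ_self
        rw [ih] at this
        exact hjump _ this
    obtain ⟨x, hx, hx'⟩ := (hDae.and (measure_eq_zero_iff_ae_notMem.1 hω)).exists
    exact hx' hx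
  have hmap := Measure.infinitePi_map_eval (fun _ : Site d => μ) 0
  have hf : Measurable fun p : ProbVec d => p.1 0 :=
    (measurable_pi_apply (0 : Site d)).comp measurable_subtype_coe
  have hm : MeasurableSet {p : ProbVec d | p.1 0 ≠ 1} := (hf (measurableSet_singleton 1)).compl
  rw [← hmap]
  exact (ae_map_iff (measurable_pi_apply (0 : Site d)).aemeasurable hm).2 hae

/-- If idling is possible, then it is jointly possible with some nonzero step. -/
lemma Transient.exists_step_with_idle (h : Transient μ uhat) (h0 : μ {p | 0 < p.1 0} ≠ 0) :
    ∃ s, s ≠ 0 ∧ μ {p | 0 < p.1 s ∧ 0 < p.1 0} ≠ 0 := by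
  by_contra hne
  push Not at hne
  have hall : ∀ᵐ p ∂μ, ∀ s : Site d, s ≠ 0 → ¬ (0 < p.1 s ∧ 0 < p.1 0) :=
    ae_all_iff.2 fun s => by
      by_cases hs : s = 0
      · exact ae_of_all _ fun p hs' => absurd hs hs'
      · filter_upwards [measure_eq_zero_iff_ae_notMem.1 (hne s hs)] with p hp _
        exact hp
  refine h0 (measure_eq_zero_iff_ae_notMem.2 ?_)
  filter_upwards [hall, h.ae_ne_one] with p hp hp1 hp0
  refine hp1 ?_
  -- If idling were never compatible with a nonzero step, it would carry the whole mass wherever it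
  -- is possible.
  have hz : ∀ s, s ≠ 0 → p.1 s = 0 := fun s hs => le_antisymm
    (not_lt.1 fun hpos => hp s hs ⟨hpos, hp0⟩) (p.2.1 s)
  exact (hasSum_single 0 hz).unique p.2.2

/-- There is an admissible step off the line spanned by a given admissible step, and an integral
functional that detects it. -/
lemma Regular.exists_transverse_step (h : Regular μ) {z₀ : Site d} (hz₀ : z₀ ≠ 0) :
    ∃ y, 0 < meanJump μ y ∧ ∃ φ : Site d →+ ℤ, φ z₀ = 0 ∧ φ y ≠ 0 := by
  obtain ⟨_, ⟨y, hy, rfl⟩, hline⟩ := Set.not_subset.1 (h.1 (toVec z₀))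
  refine ⟨y, hy, ?_⟩
  obtain ⟨i, hi⟩ : ∃ i, z₀ i ≠ 0 := by
    by_contra hne
    push Not at hne
    exact hz₀ (funext hne)
  -- If all these `2 × 2` minors vanished, `y` would be the multiple `y i / z₀ i` of `z₀`; a nonzero
  -- minor is the desired functional evaluated at `y`.
  obtain ⟨j, hj⟩ : ∃ j, z₀ i * y j - z₀ j * y i ≠ 0 := by
    by_contra hne
    push Not at hne
    refine hline ⟨(y i : ℝ) / z₀ i, ?_⟩
    ext j
    have hi' : (z₀ i : ℝ) ≠ 0 := by exact_mod_cast hi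
    have hj : (z₀ i : ℝ) * y j - z₀ j * y i = 0 := by exact_mod_cast hne j
    simp only [toVec, PiLp.smul_apply, smul_eq_mul]
    field_simp
    linarith
  refine ⟨AddMonoidHom.mk' (fun x => z₀ i * x j - z₀ j * x i) fun a b => ?_, ?_, hj⟩
  · simp only [Pi.add_apply]; ring
  · simp only [AddMonoidHom.mk'_apply]; ring

/-- Every admissible step has the same component along a direction that satisfies the cycle
relation. -/
theorem CycleRelation.inner_step {u : EuclideanSpace ℝ (Fin d)} {c : ℝ}
    (hC : CycleRelation μ uhat u c) (htrans : Transient μ uhat) (hR : Regular μ) (z : Site d)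
    (hz : 0 < meanJump μ z) : inner ℝ u (toVec z) = c := by
  have hnoidle : ∀ {s : Site d}, 0 < meanJump μ s →
      μ {p | 0 < p.1 s ∧ ((0 : ℕ) ≠ 0 → 0 < p.1 0)} ≠ 0 := by
    intro s hs
    simpa using (meanJump_pos_iff μ s).1 hs
  obtain ⟨z₀, hz₀, hup⟩ := htrans.exists_upward_step
  have hz₀ne : z₀ ≠ 0 := by rintro rfl; simp at hup
  have hz₀' := (meanJump_pos_iff μ z₀).1 hz₀
  -- With `s = z₀` the path only climbs and never returns, and the relation reads `(k + 1) u·z₀ = (k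
  -- + 1) c`.
  have hcz₀ : inner ℝ u (toVec z₀) = c := by
    obtain ⟨k, hk⟩ := hC.jump_transverse hz₀' hup (hnoidle hz₀) (fun j hj => by
      have := congrArg (· ⬝ᵥ uhat) hj
      simp only [add_dotProduct, nsmul_dotProduct, zero_dotProduct] at this
      have hj' : 0 ≤ (j : ℤ) * (z₀ ⬝ᵥ uhat) := by positivity
      linarith)
    have hk0 : (k : ℝ) + 1 ≠ 0 := by positivity
    refine mul_left_cancel₀ hk0 ?_
    push_cast at hk
    linarith
  obtain ⟨y, hy, φ, hφz₀, hφy⟩ := hR.exists_transverse_step hz₀ne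
  have hφn : ∀ (a : Site d) (n : ℕ), φ (a + n • z₀) = φ a := fun a n => by
    rw [map_add, map_nsmul, hφz₀, smul_zero, add_zero]
  have hcy : inner ℝ u (toVec y) = c := by
    obtain ⟨k, hk⟩ := hC.jump_transverse hz₀' hup (hnoidle hy) (fun j hj => by
      have := congrArg φ hj
      rw [hφn, map_zero] at this
      exact hφy this)
    rw [hcz₀] at hk
    push_cast at hk
    linarith
  have hjump : ∀ (s : Site d) (r : ℕ), s ≠ 0 → μ {p | 0 < p.1 s ∧ (r ≠ 0 → 0 < p.1 0)} ≠ 0 →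
      inner ℝ u (toVec s) = (r + 1) * c := by
    intro s r hs0 hs
    -- Either the final run of `z₀` avoids the site of the jump, or `s` is a negative multiple of
    -- `z₀`; then `φ s = 0` and the detour through `y` applies.
    by_cases htr : ∀ j : ℕ, s + j • z₀ ≠ 0
    · obtain ⟨k, hk⟩ := hC.jump_transverse hz₀' hup hs htr
      rw [hcz₀] at hk
      linarith
    · push Not at htr
      obtain ⟨j, hj⟩ := htr
      have hφs : φ s = 0 := by rw [← hφn s j, hj, map_zero]
      obtain ⟨k, hk⟩ := hC.jump_parallel hz₀' hup ((meanJump_pos_iff μ y).1 hy) hs hs0 φ hφz₀ hφy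
        hφs
      rw [hcz₀, hcy] at hk
      linarith
  by_cases hz0 : z = 0
  · subst hz0
    -- The same `s` with no idle step and with one gives `u·s = c` and `u·s = 2c`, so `c = 0`, the
    -- component of the zero step.
    obtain ⟨s, hs0, hs⟩ := htrans.exists_step_with_idle ((meanJump_pos_iff μ 0).1 hz)
    have h1 := hjump s 0 hs0 (by
      refine fun h0 => hs (measure_mono_null ?_ h0)
      exact fun p hp => ⟨hp.1, fun h => absurd rfl h⟩)
    have h2 := hjump s 1 hs0 (by simpa using hs)
    push_cast at h1 h2
    rw [toVec_zero, inner_zero_right]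
    linarith
  · have := hjump z 0 hz0 (hnoidle hz)
    simpa using this

/-- The orthogonality condition says that all admissible steps have the same component. -/
lemma mem_orthogonal_span_iff (u : EuclideanSpace ℝ (Fin d)) :
    u ∈ (Submodule.span ℝ {w : EuclideanSpace ℝ (Fin d) | ∃ x y : Site d,
          0 < meanJump μ x * meanJump μ y ∧ w = toVec x - toVec y})ᗮ ↔
      ∀ x y, 0 < meanJump μ x → 0 < meanJump μ y →
        inner ℝ u (toVec x) = inner ℝ u (toVec y) := by
  have hnn : ∀ z, 0 ≤ meanJump μ z := fun z => integral_nonneg fun ω => (ω 0).2.1 _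
  rw [Submodule.mem_orthogonal']
  constructor
  · intro h x y hx hy
    have := h _ (Submodule.subset_span ⟨x, y, mul_pos hx hy, rfl⟩)
    rwa [inner_sub_right, sub_eq_zero] at this
  · intro h w hw
    induction hw using Submodule.span_induction with
    | mem w hw =>
      obtain ⟨x, y, hxy, rfl⟩ := hw
      rw [inner_sub_right, sub_eq_zero]
      exact h x y (pos_of_mul_pos_left hxy (hnn y)) (pos_of_mul_pos_right hxy (hnn x))
    | zero => simp
    | add a b _ _ ha hb => rw [inner_add_right, ha, hb, add_zero]
    | smul r a _ ha => rw [inner_smul_right, ha, mul_zero]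

end Assumptions

end RWRE

/-! ### Degenerate directions of the diffusion matrix -/

theorem lemma2p2 {d : ℕ} (μ : Measure (RWRE.ProbVec d)) [IsProbabilityMeasure μ]
    (uhat : RWRE.Site d)
    (htrans : RWRE.Transient μ uhat)
    (hT : RWRE.MomentHyp μ uhat)
    (hS : RWRE.BoundedSteps μ)
    (hR : RWRE.Regular μ)
    (u : EuclideanSpace ℝ (Fin d)) :
    u.ofLp ⬝ᵥ (RWRE.diffusion μ uhat *ᵥ u.ofLp) = 0 ↔
      u ∈ (Submodule.span ℝ
        {w : EuclideanSpace ℝ (Fin d) | ∃ x y : RWRE.Site d,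
          0 < RWRE.meanJump μ x * RWRE.meanJump μ y ∧
            w = RWRE.toVec x - RWRE.toVec y})ᗮ := by
  have hreg := RWRE.regenSquareIntegrable hT hR.pos_dim hS
  rw [hreg.quadForm_eq_zero_iff u, RWRE.mem_orthogonal_span_iff]
  constructor
  · intro h x y hx hy
    have hC := RWRE.cycleRelation hreg.stay_ne_zero hreg.ae_tau
      (RWRE.ae_averaged_of_ae_regenLaw h)
    rw [hC.inner_step htrans hR x hx, hC.inner_step htrans hR y hy]
  · intro h
    -- Any admissible step can supply the common value `c`; transience provides one.
    obtain ⟨z, hz, -⟩ := htrans.exists_upward_step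
    exact hreg.inner_posTau_of_forall_step fun y hy => h y z hy hz
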